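/- A non-interactive local protocol $\Pi$ for $n$ users with inputs in $[d]$ consists of a public random string $S$ drawn from some distribution, local randomizers $R_1,\dots,R_n$ (user $i$ with datum $x_i$ sends $y_i\sim R_i(x_i,S)$, independently given $S$, in a message space $\mathcal Y$ whose $\sigma$-algebra is countably generated), and an aggregator that computes a possibly randomized output from $(S,y_1,\dots,y_n)$. It is $\varepsilon$-locally differentially private ($\varepsilon$-LDP) if $\Pr[R_i(x,S)\in Y]\le e^{\varepsilon}\Pr[R_i(x',S)\in Y]$ for all $i$, all $x,x'\in[d]$, every fixed $S$ and every measurable $Y\subseteq\mathcal Y$. Let $|\vec R|_{\neq}$ be the number of distinct randomizers among $R_1,\dots,R_n$. For a distribution $\mathbf P$ on $[d]$, $\Pi(\mathbf P)$ is the law of the output when the $n$ data are independent samples from $\mathbf P$. An attacker $M$ corrupting $m$ users sees $S$ (but neither the data nor the honest messages) and chooses, possibly at random, a set $C$ of $m$ users and their messages; the other users behave honestly; $\mathrm{Manip}_{m,n}(\Pi,\mathbf P,M)$ is the resulting law of the output. Let $\mathbf U$ be the uniform distribution on $[d]$ and $\|\mathbf U-\mathbf P\|_1=\sum_{j}|\mathbf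 U(j)-\mathbf P(j)|$. **Theorem.** For every $\varepsilon_0>0$ there are constants $c_1,c_2>0$, depending only on $\varepsilon_0$, such that the following holds for all $0<\varepsilon\le\varepsilon_0$, all $n\ge 2$, $0\le m\le n$, $d\ge 2$, and every $\varepsilon$-LDP protocol $\Pi$ for $n$ users with inputs in $[d]$. Put $$\alpha(L)=\min\Big\{1,\ \frac1\varepsilon\sqrt{\frac dL}\Big(\frac1{\sqrt n}+\frac mn\Big)\Big\}.$$ 1. There are an attacker $M$ corrupting $m$ users and a distribution $\mathbf P$ on $[d]$ with $c_1\,\alpha(\log n)\le\|\mathbf U-\mathbf P\|_1\le c_2\,\alpha(\log n)$ such that $\Pi$ cannot distinguish manipulated uniform data from unmanipulated data from $\mathbf P$: for every event $E$ on outputs, $$\big|\Pr[\mathrm{Manip}_{m,n}(\Pi,\mathbf U,M)\in E]-\Pr[\Pi(\mathbf P)\in E]\big|\le\tfrac13 .$$ 2. If $\mathcal Y$ is finite, then there are also such an $M$ and $\mathbf P$ with $\alpha(\log n)$ replaced by $\alpha\big(\log(12\,|\mathcal Y|\,|\vec R|_{\neq})\big)$. Thus the factor $\sqrt{\log n}$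 is replaced by $\sqrt{\log(12|\mathcal Y||\vec R|_{\neq})}$, which is bounded for protocols with a bounded message space and boundedly many distinct randomizers. -/

import Mathlib

open MeasureTheory ProbabilityTheory

noncomputable section

/-- The product kernel: given `a`, the coordinates are independent and the `i`-th one has
law `κ i a`. -/
def piKernel {A Y : Type*} [MeasurableSpace A] [MeasurableSpace Y] {n : ℕ}
    (κ : Fin n → Kernel A Y) [∀ i, IsMarkovKernel (κ i)] : Kernel A (Fin n → Y) where
  toFun a := Measure.pi (fun i => κ i a)
  measurable' := by
    refine Measurable.measure_of_isPiSystem_of_isProbabilityMeasure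
      generateFrom_pi.symm isPiSystem_pi ?_
    rintro _ ⟨t, ht, rfl⟩
    simp only [Measure.pi_pi]
    exact Finset.measurable_fun_prod _ fun i _ => (κ i).measurable_coe (ht i (Set.mem_univ i))

instance {A Y : Type*} [MeasurableSpace A] [MeasurableSpace Y] {n : ℕ}
    (κ : Fin n → Kernel A Y) [∀ i, IsMarkovKernel (κ i)] : IsMarkovKernel (piKernel κ) where
  isProbabilityMeasure a :=
    inferInstanceAs (IsProbabilityMeasure (Measure.pi (fun i => κ i a)))

/-- A non-interactive local protocol for `n` users with data universe `X`, public strings in `S`,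
messages in `Y` and outputs in `Z`. User `i` sends a message drawn from `rand i (x i, s)`, where
`s` is the public string, and the (possibly randomized) aggregator sees the public string and all
messages. -/
structure LocalProtocol (X S Y Z : Type*) [MeasurableSpace X] [MeasurableSpace S]
    [MeasurableSpace Y] [MeasurableSpace Z] (n : ℕ) where
  pub : Measure S
  pub_prob : IsProbabilityMeasure pub
  rand : Fin n → Kernel (X × S) Y
  rand_markov : ∀ i, IsMarkovKernel (rand i)
  agg : Kernel (S × (Fin n → Y)) Z
  agg_markov : IsMarkovKernel agg

attribute [instance] LocalProtocol.pub_prob LocalProtocol.rand_markov LocalProtocol.agg_markov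

namespace LocalProtocol

variable {X S Y Z : Type*} [MeasurableSpace X] [MeasurableSpace S]
    [MeasurableSpace Y] [MeasurableSpace Z] {n : ℕ}

/-- `ε`-local differential privacy. The probability is over the coins of the randomizer only, for
each fixed public string. -/
def IsLDP (Pr : LocalProtocol X S Y Z n) (ε : ℝ) : Prop :=
  ∀ (i : Fin n) (x x' : X) (s : S) (E : Set Y), MeasurableSet E →
    Pr.rand i (x, s) E ≤ ENNReal.ofReal (Real.exp ε) * Pr.rand i (x', s) E

/-- The number of distinct randomizers among those of the `n` users. -/
def numRandomizers (Pr : LocalProtocol X S Y Z n) : ℕ := (Set.range Pr.rand).ncard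

/-- The messages of honest users, given the data vector and the public string. -/
def messages (Pr : LocalProtocol X S Y Z n) : Kernel ((Fin n → X) × S) (Fin n → Y) :=
  piKernel fun i => (Pr.rand i).comap (fun p : (Fin n → X) × S => (p.1 i, p.2)) (by fun_prop)

instance (Pr : LocalProtocol X S Y Z n) : IsMarkovKernel Pr.messages := by
  unfold messages; infer_instance

/-- The law of the output of the unmanipulated protocol, given the data vector. -/
def output (Pr : LocalProtocol X S Y Z n) : Kernel (Fin n → X) Z :=
  Pr.agg ∘ₖ (Kernel.const _ Pr.pub ⊗ₖ Pr.messages)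

/-- The law of the output of the unmanipulated protocol when the data are `n` independent samples
from `P`. -/
def outputDist (Pr : LocalProtocol X S Y Z n) (P : Measure X) : Measure Z :=
  Pr.output ∘ₘ Measure.pi (fun _ : Fin n => P)

end LocalProtocol

/-- An attacker corrupting `m` out of `n` users: having seen the public string (but neither the
data nor the messages of the honest users), it draws, jointly and possibly at random, a set of
exactly `m` corrupted users and their messages. The components of the message vector outside the
corrupted set are never used. -/
structure Attacker (S Y : Type*) [MeasurableSpace S] [MeasurableSpace Y] (m n : ℕ) where
  strat : Kernel S (Finset (Fin n) × (Fin n → Y))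
  strat_markov : IsMarkovKernel strat
  card_eq : ∀ s, ∀ᵐ a ∂(strat s), a.1.card = m

attribute [instance] Attacker.strat_markov

theorem measurableSet_corrupted {A S Y : Type*} [MeasurableSpace A] [MeasurableSpace S]
    [MeasurableSpace Y] {n : ℕ} (i : Fin n) :
    MeasurableSet {p : A × (S × (Finset (Fin n) × (Fin n → Y))) | i ∈ p.2.2.1} := by
  have h : Measurable fun p : A × (S × (Finset (Fin n) × (Fin n → Y))) => p.2.2.1 := by fun_prop
  exact h (Set.toFinite {C : Finset (Fin n) | i ∈ C}).measurableSet

namespace LocalProtocol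

variable {X S Y Z : Type*} [MeasurableSpace X] [MeasurableSpace S]
    [MeasurableSpace Y] [MeasurableSpace Z] {m n : ℕ}

open Classical in
/-- The message of user `i` in the manipulation game, given the data, the public string, the
corrupted set and the messages chosen by the attacker: a corrupted user sends the attacker's
message, any other user runs its randomizer honestly. -/
def manipMessage (Pr : LocalProtocol X S Y Z n) (i : Fin n) :
    Kernel ((Fin n → X) × (S × (Finset (Fin n) × (Fin n → Y)))) Y :=
  Kernel.piecewise (measurableSet_corrupted i)
    (Kernel.deterministic (fun p => p.2.2.2 i) (by fun_prop))
    ((Pr.rand i).comap (fun p => (p.1 i, p.2.1)) (by fun_prop))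

instance (Pr : LocalProtocol X S Y Z n) (i : Fin n) : IsMarkovKernel (Pr.manipMessage i) := by
  unfold manipMessage; infer_instance

/-- The law of the output of the manipulation game, given the data vector: the public string is
drawn, then the attacker moves, then all messages are sent, then the aggregator sees the public
string and the messages. -/
def manipOutput (Pr : LocalProtocol X S Y Z n) (M : Attacker S Y m n) : Kernel (Fin n → X) Z :=
  Pr.agg ∘ₖ
    (((Kernel.const (Fin n → X) Pr.pub ⊗ₖ M.strat.comap Prod.snd measurable_snd) ⊗ₖ
      piKernel Pr.manipMessage).map
        (fun p : (S × (Finset (Fin n) × (Fin n → Y))) × (Fin n → Y) => (p.1.1, p.2)))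

/-- The law of the output of the manipulation game when the data are `n` independent samples
from `P`. -/
def manipOutputDist (Pr : LocalProtocol X S Y Z n) (P : Measure X) (M : Attacker S Y m n) :
    Measure Z :=
  Pr.manipOutput M ∘ₘ Measure.pi (fun _ : Fin n => P)

end LocalProtocol

/-- The `ℓ₁` distance of two distributions on `{1, …, d}`. -/
def l1Dist {d : ℕ} (P Q : PMF (Fin d)) : ℝ := ∑ j, |(P j).toReal - (Q j).toReal|

/-- `μ` and `ν` differ by at most `1/3` on every event: no test between them is right with
probability greater than `2/3` under both. -/
def Indistinguishable {Z : Type*} [MeasurableSpace Z] (μ ν : Measure Z) : Prop :=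
  ∀ E, MeasurableSet E → |μ.real E - ν.real E| ≤ 1 / 3

/-- The quantity `(1/ε) √(d/L) (1/√n + m/n)`. -/
def skew (ε L : ℝ) (d m n : ℕ) : ℝ :=
  1 / ε * √(d / L) * (1 / √n + m / n)

/-- Some attack with `m` corrupted users makes uniform data look like data from some `P` whose
`ℓ₁` distance to the uniform distribution is between `c₁ r` and `c₂ r`. -/
def ManipulableBy {S Y Z : Type*} [MeasurableSpace S] [MeasurableSpace Y] [MeasurableSpace Z]
    {n d : ℕ} [NeZero d] (Pr : LocalProtocol (Fin d) S Y Z n) (m : ℕ) (c₁ c₂ r : ℝ) : Prop :=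
  ∃ (M : Attacker S Y m n) (P : PMF (Fin d)),
    c₁ * r ≤ l1Dist (PMF.uniformOfFintype (Fin d)) P ∧
    l1Dist (PMF.uniformOfFintype (Fin d)) P ≤ c₂ * r ∧
    Indistinguishable (Pr.manipOutputDist (PMF.uniformOfFintype (Fin d)).toMeasure M)
      (Pr.outputDist P.toMeasure)

end

open scoped ENNReal

/-! Skew the uniform law by `a` along random signs that are opposite on paired elements
(`skewedPMF`). Under such data a user's message has density `1 + a * tilt` relative to its law under
uniform data (`mixFst_skewedPMF`). Privacy bounds the deviation of each likelihood ratio from 1 by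
some δ = O(ε). At a fixed message the tilt is 1/d times a sum of ⌊d/2⌋ independently signed
differences of deviations. Over the signs `σ` it is therefore sub-Gaussian with variance proxy 2δ²/d
(`sum_exp_tilt_le`), so its typical size is ε/√d.

If m/n ≤ 1/√n, no manipulation is needed: the chi-square divergence of the n messages is of order n
a² δ²/d, which is small for a up to a constant times √d/(ε√n) (`manipulableBy_of_small_skew`).
Otherwise corrupted users amplify the tilt (`manipulableBy_of_tail`). If each user is corrupted with
probability w = m/(10n) and then sends a message of density 1 + l * tilt, where w * l = a, the
mixture with honest behaviour is exactly the skewed law. To get a genuine density, l * tilt is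
clamped to [-1/2, 1/2] and recentred, at a cost per user of twice the probability that |l * tilt| >
1/2 (`lintegral_sub_density_le`). For l of order √(d/L)/ε the fraction of bad signs at a given
message is at most 2exp(-25L). The two values of L are those for which a union bound over users
(`sum_min_le_of_users`) or over pairs of a randomizer and a message (`sum_min_le_of_finite`)
succeeds.

These bounds hold for each public string on average over `σ`, so a single `σ` is good on average
over the public string (`exists_lintegral_le_of_sum_le`). Independent corruption is simulated with
exactly m users, up to the event that more than m coins succeed (`exists_attacker`), which Markov's
inequality bounds by 1/10. -/

/-! ### Total variation between product measures. -/

theorem lintegral_pi_prod {ι : Type*} [Fintype ι] {α : ι → Type*} [∀ i, MeasurableSpace (α i)]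
    (μ : ∀ i, Measure (α i)) [∀ i, IsProbabilityMeasure (μ i)] {f : ∀ i, α i → ℝ≥0∞}
    (hf : ∀ i, Measurable (f i)) :
    ∫⁻ x, ∏ i, f i (x i) ∂Measure.pi μ = ∏ i, ∫⁻ x, f i x ∂μ i := by
  rw [lintegral_prod_eq_prod_lintegral_of_indepFun Finset.univ (fun i (x : ∀ i, α i) => f i (x i))
    (iIndepFun_pi fun i => (hf i).aemeasurable) (fun i => (hf i).comp (measurable_pi_apply i))]
  refine Finset.prod_congr rfl fun i _ => ?_
  rw [← (measurePreserving_eval μ i).lintegral_comp (hf i)]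

theorem indicator_pi_prod {ι : Type*} [Fintype ι] {α : ι → Type*} (s : ∀ i, Set (α i))
    (f : ∀ i, α i → ℝ≥0∞) (x : ∀ i, α i) :
    (Set.univ.pi s).indicator (fun x => ∏ i, f i (x i)) x = ∏ i, (s i).indicator (f i) (x i) := by
  classical
  by_cases h : x ∈ Set.univ.pi s
  · rw [Set.indicator_of_mem h]
    exact Finset.prod_congr rfl fun i _ => (Set.indicator_of_mem (h i trivial) _).symm
  · rw [Set.indicator_of_notMem h]
    simp only [Set.mem_pi, Set.mem_univ, true_imp_iff, not_forall] at h
    obtain ⟨i, hi⟩ := h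
    exact (Finset.prod_eq_zero (Finset.mem_univ i) (Set.indicator_of_notMem hi _)).symm

theorem pi_withDensity_eq {ι : Type*} [Fintype ι] {α : ι → Type*} [∀ i, MeasurableSpace (α i)]
    (μ : ∀ i, Measure (α i)) [∀ i, IsProbabilityMeasure (μ i)] {f : ∀ i, α i → ℝ≥0∞}
    (hf : ∀ i, Measurable (f i)) [∀ i, SigmaFinite ((μ i).withDensity (f i))] :
    Measure.pi (fun i => (μ i).withDensity (f i)) =
      (Measure.pi μ).withDensity fun x => ∏ i, f i (x i) := by
  refine Measure.pi_eq fun s hs => ?_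
  rw [withDensity_apply _ (MeasurableSet.univ_pi hs), ← lintegral_indicator (MeasurableSet.univ_pi hs)]
  simp_rw [indicator_pi_prod]
  rw [lintegral_pi_prod μ fun i => (hf i).indicator (hs i)]
  refine Finset.prod_congr rfl fun i _ => ?_
  rw [withDensity_apply _ (hs i), lintegral_indicator (hs i)]

/-- Every test function with values in `[0, 1]` has `μ`-mean at most `δ` above its `ν`-mean. -/
def MeasureTheory.Measure.WithinTV {α : Type*} [MeasurableSpace α] (μ ν : Measure α) (δ : ℝ≥0∞) :
    Prop :=
  ∀ f : α → ℝ≥0∞, Measurable f → (∀ x, f x ≤ 1) → ∫⁻ x, f x ∂μ ≤ ∫⁻ x, f x ∂ν + δ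

theorem withinTV_one {α : Type*} [MeasurableSpace α] (μ ν : Measure α) [IsProbabilityMeasure μ] :
    μ.WithinTV ν 1 := by
  intro f hf h1
  calc ∫⁻ x, f x ∂μ ≤ ∫⁻ _, 1 ∂μ := lintegral_mono h1
    _ = 1 := by simp
    _ ≤ _ := le_add_self

/-- A union bound in Weierstrass form: 1 - ∏ aᵢ ≤ ∑ (1 - aᵢ), with `e i` dominating the defect of `a
i`. -/
theorem one_le_prod_add_sum {ι : Type*} (s : Finset ι) (a e : ι → ℝ≥0∞) (ha : ∀ i, a i ≤ 1)
    (hae : ∀ i, 1 ≤ a i + e i) : 1 ≤ ∏ i ∈ s, a i + ∑ i ∈ s, e i := by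
  classical
  induction s using Finset.induction_on with
  | empty => simp
  | insert i s hi ih =>
    rw [Finset.prod_insert hi, Finset.sum_insert hi]
    calc (1 : ℝ≥0∞) ≤ a i * 1 + e i := by simpa using hae i
      _ ≤ a i * (∏ i ∈ s, a i + ∑ i ∈ s, e i) + e i := by gcongr
      _ = a i * ∏ i ∈ s, a i + (e i + a i * ∑ i ∈ s, e i) := by ring
      _ ≤ a i * ∏ i ∈ s, a i + (e i + 1 * ∑ i ∈ s, e i) := by gcongr; exact ha i
      _ = _ := by rw [one_mul]

/-- Total variation is subadditive over independent coordinates. The product of the pointwise minima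
lies below both product densities, and the mass it misses is at most the sum of the masses missed in
each coordinate. -/
theorem withinTV_pi_withDensity {ι : Type*} [Fintype ι] {α : ι → Type*}
    [∀ i, MeasurableSpace (α i)] (μ : ∀ i, Measure (α i)) [∀ i, IsProbabilityMeasure (μ i)]
    {f h : ∀ i, α i → ℝ≥0∞} (hf : ∀ i, Measurable (f i)) (hh : ∀ i, Measurable (h i))
    [∀ i, IsProbabilityMeasure ((μ i).withDensity (f i))]
    [∀ i, IsProbabilityMeasure ((μ i).withDensity (h i))] :
    (Measure.pi fun i => (μ i).withDensity (f i)).WithinTV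
      (Measure.pi fun i => (μ i).withDensity (h i)) (∑ i, ∫⁻ x, (f i x - h i x) ∂μ i) := by
  intro F hF hF1
  have hpm : ∀ {k : ∀ i, α i → ℝ≥0∞}, (∀ i, Measurable (k i)) →
      Measurable fun x : ∀ i, α i => ∏ i, k i (x i) := fun hk =>
    Finset.measurable_fun_prod _ fun i _ => (hk i).comp (measurable_pi_apply i)
  have hk : ∀ i, Measurable fun x => min (f i x) (h i x) := fun i => (hf i).min (hh i)
  have hint : ∀ {k : ∀ i, α i → ℝ≥0∞}, (∀ i, Measurable (k i)) →
      (∀ i, IsProbabilityMeasure ((μ i).withDensity (k i))) → ∀ i, ∫⁻ x, k i x ∂μ i = 1 := by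
    intro k hk hp i
    have := (hp i).measure_univ
    rwa [withDensity_apply _ MeasurableSet.univ, Measure.restrict_univ] at this
  have hf1 := hint hf inferInstance
  rw [pi_withDensity_eq μ hf, pi_withDensity_eq μ hh,
    lintegral_withDensity_eq_lintegral_mul _ (hpm hf) hF,
    lintegral_withDensity_eq_lintegral_mul _ (hpm hh) hF]
  simp only [Pi.mul_apply]
  set A : (∀ i, α i) → ℝ≥0∞ := fun x => ∏ i, f i (x i) with hA
  set C : (∀ i, α i) → ℝ≥0∞ := fun x => ∏ i, min (f i (x i)) (h i (x i)) with hC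
  have hCA : ∀ x, C x ≤ A x := fun x => Finset.prod_le_prod' fun i _ => min_le_left _ _
  have hCB : ∀ x, C x ≤ ∏ i, h i (x i) := fun x => Finset.prod_le_prod' fun i _ => min_le_right _ _
  have hAint : ∫⁻ x, A x ∂Measure.pi μ = 1 := by
    rw [hA, lintegral_pi_prod μ hf]; simp [hf1]
  have hCint : ∫⁻ x, C x ∂Measure.pi μ = ∏ i, ∫⁻ x, min (f i x) (h i x) ∂μ i :=
    lintegral_pi_prod μ hk
  have hsub : ∫⁻ x, (A x - C x) ∂Measure.pi μ ≤ ∑ i, ∫⁻ x, (f i x - h i x) ∂μ i := by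
    rw [lintegral_sub (hpm hk) (by
      refine ((lintegral_mono hCA).trans_lt ?_).ne
      rw [hAint]; exact ENNReal.one_lt_top) (ae_of_all _ hCA), hAint, hCint, tsub_le_iff_left]
    refine one_le_prod_add_sum _ _ _ (fun i => ?_) (fun i => ?_)
    · rw [← hf1 i]; exact lintegral_mono fun x => min_le_left _ _
    · rw [← hf1 i, ← lintegral_add_left (hk i)]
      refine lintegral_mono fun x => ?_
      rcases le_total (f i x) (h i x) with hle | hle
      · simp [hle]
      · simp [hle]
  calc ∫⁻ x, A x * F x ∂Measure.pi μ
      ≤ ∫⁻ x, (C x * F x + (A x - C x)) ∂Measure.pi μ := by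
        refine lintegral_mono fun x => ?_
        calc A x * F x = (C x + (A x - C x)) * F x := by rw [add_tsub_cancel_of_le (hCA x)]
          _ = C x * F x + (A x - C x) * F x := add_mul _ _ _
          _ ≤ C x * F x + (A x - C x) * 1 := by gcongr; exact hF1 x
          _ = _ := by rw [mul_one]
    _ = ∫⁻ x, C x * F x ∂Measure.pi μ + ∫⁻ x, (A x - C x) ∂Measure.pi μ :=
        lintegral_add_left ((hpm hk).mul hF) _
    _ ≤ _ := by
        refine add_le_add (lintegral_mono fun x => ?_) hsub
        gcongr; exact hCB x

theorem isProbabilityMeasure_withDensity_one_add {α : Type*} [MeasurableSpace α] (μ : Measure α)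
    [IsProbabilityMeasure μ] {g : α → ℝ} (hg : Integrable g μ) (hg1 : ∀ x, 0 ≤ 1 + g x)
    (hg0 : ∫ x, g x ∂μ = 0) :
    IsProbabilityMeasure (μ.withDensity fun x => ENNReal.ofReal (1 + g x)) := ⟨by
  have h : Integrable (fun x => 1 + g x) μ := (integrable_const _).add hg
  rw [withDensity_apply _ MeasurableSet.univ, Measure.restrict_univ,
    ← ofReal_integral_eq_lintegral_ofReal h (ae_of_all _ hg1),
    integral_add (integrable_const _) hg, hg0]
  simp⟩

/-- Chi-square bound: the second moment of the product density factorizes into ∏ (1 + E gᵢ²), so its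
variance is at most exp X - 1, where X is the sum of the E gᵢ². The free parameter `τ` linearizes
the square root of Cauchy–Schwarz, which leaves a bound affine in X that can be averaged over signs
directly. -/
theorem withinTV_pi_of_sq {ι : Type*} [Fintype ι] {α : ι → Type*}
    [∀ i, MeasurableSpace (α i)] (μ : ∀ i, Measure (α i)) [∀ i, IsProbabilityMeasure (μ i)]
    {g : ∀ i, α i → ℝ} (hg : ∀ i, Measurable (g i)) (hg1 : ∀ i x, |g i x| ≤ 1)
    (hg0 : ∀ i, ∫ x, g i x ∂μ i = 0)
    {τ : ℝ} (hτ : 0 < τ) (hτ1 : τ ≤ 1) :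
    (Measure.pi μ).WithinTV
      (Measure.pi fun i => (μ i).withDensity fun x => ENNReal.ofReal (1 + g i x))
      (ENNReal.ofReal (τ / 2 + (∑ i, ∫ x, g i x ^ 2 ∂μ i) / τ)) := by
  have hgi : ∀ i, Integrable (g i) (μ i) := fun i =>
    Integrable.of_bound (hg i).aestronglyMeasurable 1 (ae_of_all _ (hg1 i))
  have hg2i : ∀ i, Integrable (fun x => g i x ^ 2) (μ i) := fun i =>
    Integrable.of_bound ((hg i).pow_const 2).aestronglyMeasurable 1
      (ae_of_all _ fun x => by
        rw [Real.norm_eq_abs, abs_pow]; exact pow_le_one₀ (abs_nonneg _) (hg1 i x))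
  have hnn : ∀ i x, 0 ≤ 1 + g i x := fun i x => by linarith [neg_le_of_abs_le (hg1 i x)]
  have hprob : ∀ i, IsProbabilityMeasure ((μ i).withDensity fun x => ENNReal.ofReal (1 + g i x)) :=
    fun i => isProbabilityMeasure_withDensity_one_add _ (hgi i) (hnn i) (hg0 i)
  intro F hF hF1
  have hm : ∀ i, Measurable fun x => ENNReal.ofReal (1 + g i x) := fun i =>
    ((hg i).const_add 1).ennreal_ofReal
  set X := ∑ i, ∫ x, g i x ^ 2 ∂μ i with hX
  have hX0 : 0 ≤ X := Finset.sum_nonneg fun i _ => integral_nonneg fun x => sq_nonneg _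
  -- For X > 1 the claimed error exceeds 1, since τ ≤ 1. Otherwise exp X - 1 ≤ 2X.
  by_cases hX1 : 1 < X
  · refine (withinTV_one (Measure.pi μ) (Measure.pi fun i => (μ i).withDensity fun x =>
      ENNReal.ofReal (1 + g i x)) F hF hF1).trans ?_
    gcongr
    rw [ENNReal.one_le_ofReal]
    have : 1 ≤ X / τ := by rw [le_div_iff₀ hτ]; linarith
    linarith
  push Not at hX1
  have hpm : Measurable fun x : ∀ i, α i => ∏ i, ENNReal.ofReal (1 + g i (x i)) :=
    Finset.measurable_fun_prod _ fun i _ => (hm i).comp (measurable_pi_apply i)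
  rw [pi_withDensity_eq μ hm, lintegral_withDensity_eq_lintegral_mul _ hpm hF]
  simp only [Pi.mul_apply]
  set G : (∀ i, α i) → ℝ := fun x => ∏ i, (1 + g i (x i)) with hG
  have hGm : Measurable G := Finset.measurable_fun_prod _ fun i _ =>
    ((hg i).const_add 1).comp (measurable_pi_apply i)
  have hGb : ∀ x, |G x| ≤ 2 ^ Fintype.card ι := fun x => by
    rw [hG, Finset.abs_prod]
    refine (Finset.prod_le_prod (fun i _ => abs_nonneg _) fun i _ =>
      (?_ : |1 + g i (x i)| ≤ 2)).trans (by simp)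
    rw [abs_of_nonneg (hnn _ _)]; linarith [le_of_abs_le (hg1 i (x i))]
  have hGi : Integrable G (Measure.pi μ) :=
    Integrable.of_bound hGm.aestronglyMeasurable _ (ae_of_all _ hGb)
  have hG2i : Integrable (fun x => G x ^ 2) (Measure.pi μ) :=
    Integrable.of_bound (hGm.pow_const 2).aestronglyMeasurable ((2 ^ Fintype.card ι) ^ 2)
      (ae_of_all _ fun x => by
        rw [Real.norm_eq_abs, abs_pow]; exact pow_le_pow_left₀ (abs_nonneg _) (hGb x) 2)
  have hG1 : ∫ x, G x ∂Measure.pi μ = 1 := by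
    rw [hG, integral_fintype_prod_eq_prod (fun i x => 1 + g i x)]
    refine Finset.prod_eq_one fun i _ => ?_
    rw [integral_add (integrable_const _) (hgi i), hg0 i]; simp
  have hG2 : ∫ x, G x ^ 2 ∂Measure.pi μ ≤ Real.exp X := by
    have : (fun x => G x ^ 2) = fun x => ∏ i, (1 + g i (x i)) ^ 2 := by
      ext x; rw [hG, Finset.prod_pow]
    rw [this, integral_fintype_prod_eq_prod (fun i x => (1 + g i x) ^ 2), hX, Real.exp_sum]
    refine Finset.prod_le_prod (fun i _ => integral_nonneg fun x => sq_nonneg _) fun i _ => ?_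
    have : ∫ x, (1 + g i x) ^ 2 ∂μ i = 1 + ∫ x, g i x ^ 2 ∂μ i := by
      have h : ∀ x, (1 + g i x) ^ 2 = (1 + 2 * g i x) + g i x ^ 2 := fun x => by ring
      simp_rw [h]
      have h' : Integrable (fun x => 1 + 2 * g i x) (μ i) :=
        (integrable_const _).add ((hgi i).const_mul 2)
      rw [integral_add h' (hg2i i), integral_add (integrable_const _) ((hgi i).const_mul 2), integral_const_mul, hg0 i]
      simp
    rw [this, add_comm]
    exact Real.add_one_le_exp _
  have hexp : Real.exp X - 1 ≤ 2 * X := by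
    have := Real.abs_exp_sub_one_le (x := X) (by rwa [abs_of_nonneg hX0])
    rw [abs_of_nonneg hX0] at this
    exact (le_abs_self _).trans this
  have hbi : Integrable (fun x => (1 - G x) ^ 2) (Measure.pi μ) := by
    have h : (fun x => (1 - G x) ^ 2) = fun x => (1 - 2 * G x) + G x ^ 2 := by ext x; ring
    rw [h]
    exact ((integrable_const _).sub (hGi.const_mul 2)).add hG2i
  have hvar : ∫ x, (1 - G x) ^ 2 ∂Measure.pi μ ≤ 2 * X := by
    have h : (fun x => (1 - G x) ^ 2) = fun x => (1 - 2 * G x) + G x ^ 2 := by ext x; ring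
    have h' : Integrable (fun x => 1 - 2 * G x) (Measure.pi μ) :=
      (integrable_const _).sub (hGi.const_mul 2)
    rw [h, integral_add h' hG2i,
      integral_sub (integrable_const _) (hGi.const_mul 2), integral_const_mul, hG1]
    simp only [integral_const, probReal_univ, smul_eq_mul]
    linarith
  have hofG : ∀ x : ∀ i, α i, ∏ i, ENNReal.ofReal (1 + g i (x i)) = ENNReal.ofReal (G x) :=
    fun x => (ENNReal.ofReal_prod_of_nonneg fun i _ => hnn i _).symm
  simp_rw [hofG]
  -- AM-GM: 1 - G ≤ τ/2 + (1 - G)²/(2τ).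
  have hpt : ∀ x, F x ≤ ENNReal.ofReal (G x) * F x +
      ENNReal.ofReal (τ / 2 + (1 - G x) ^ 2 / (2 * τ)) := by
    intro x
    have hGx : 0 ≤ G x := Finset.prod_nonneg fun i _ => hnn i _
    have h1 : 1 ≤ G x + (τ / 2 + (1 - G x) ^ 2 / (2 * τ)) := by
      have : τ / 2 + (1 - G x) ^ 2 / (2 * τ) - (1 - G x) = (τ - (1 - G x)) ^ 2 / (2 * τ) := by
        field_simp; ring
      have : 0 ≤ (τ - (1 - G x)) ^ 2 / (2 * τ) := by positivity
      linarith
    calc F x = 1 * F x := (one_mul _).symm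
      _ ≤ ENNReal.ofReal (G x + (τ / 2 + (1 - G x) ^ 2 / (2 * τ))) * F x := by
          gcongr; rwa [ENNReal.one_le_ofReal]
      _ = ENNReal.ofReal (G x) * F x + ENNReal.ofReal (τ / 2 + (1 - G x) ^ 2 / (2 * τ)) * F x := by
          rw [ENNReal.ofReal_add hGx (by positivity), add_mul]
      _ ≤ ENNReal.ofReal (G x) * F x +
          ENNReal.ofReal (τ / 2 + (1 - G x) ^ 2 / (2 * τ)) * 1 := by gcongr; exact hF1 x
      _ = _ := by rw [mul_one]
  calc ∫⁻ x, F x ∂Measure.pi μ ≤ _ := lintegral_mono hpt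
    _ = ∫⁻ x, ENNReal.ofReal (G x) * F x ∂Measure.pi μ +
        ∫⁻ x, ENNReal.ofReal (τ / 2 + (1 - G x) ^ 2 / (2 * τ)) ∂Measure.pi μ :=
        lintegral_add_left (hGm.ennreal_ofReal.mul hF) _
    _ ≤ _ := by
        gcongr
        have h' : Integrable (fun x => τ / 2 + (1 - G x) ^ 2 / (2 * τ)) (Measure.pi μ) :=
          (integrable_const _).add (hbi.div_const _)
        rw [← ofReal_integral_eq_lintegral_ofReal h' (ae_of_all _ fun x => by positivity)]
        refine ENNReal.ofReal_le_ofReal ?_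
        rw [integral_add (integrable_const _) (hbi.div_const _),
          integral_div (2 * τ) fun x => (1 - G x) ^ 2]
        simp only [integral_const, probReal_univ, smul_eq_mul, one_mul]
        have : (∫ x, (1 - G x) ^ 2 ∂Measure.pi μ) / (2 * τ) ≤ 2 * X / (2 * τ) := by gcongr
        rw [mul_div_mul_left _ _ two_ne_zero] at this
        linarith

/-! ### Independent coins choosing the corrupted users. -/

/-- The probability that independent coins with success probability `p` (and failure probability
`q`) succeed exactly on `B`. -/
noncomputable def coinWeight {n : ℕ} (p q : ℝ≥0∞) (B : Finset (Fin n)) : ℝ≥0∞ :=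
  (∏ _i ∈ B, p) * ∏ _i ∈ Bᶜ, q

theorem sum_coinWeight {n : ℕ} {p q : ℝ≥0∞} (h : p + q = 1) :
    ∑ B : Finset (Fin n), coinWeight p q B = 1 := by
  unfold coinWeight
  rw [← Fintype.prod_add]
  simp [h]

theorem sum_coinWeight_mem {n : ℕ} {p q : ℝ≥0∞} (h : p + q = 1) (i : Fin n) :
    ∑ B : Finset (Fin n), (if i ∈ B then coinWeight p q B else 0) = p := by
  -- Setting the failure weight of coin `i` to 0 leaves, in the expansion of the product, exactly
  -- the sets containing `i`.
  have h1 := Fintype.prod_add (fun _ : Fin n => p) (fun j => if j = i then 0 else q)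
  rw [← Finset.mul_prod_erase _ _ (Finset.mem_univ i), Finset.prod_congr rfl
    (fun j hj => by rw [if_neg (Finset.ne_of_mem_erase hj), h] :
      ∀ j ∈ Finset.univ.erase i, (p + if j = i then 0 else q) = 1)] at h1
  simp only [if_true, add_zero, Finset.prod_const_one, mul_one] at h1
  refine Eq.trans (Finset.sum_congr rfl fun B _ => ?_) h1.symm
  unfold coinWeight
  split_ifs with hi
  · congr 1
    refine Finset.prod_congr rfl fun j hj => ?_
    rw [if_neg]
    rintro rfl
    exact Finset.mem_compl.1 hj hi
  · rw [Finset.prod_eq_zero (s := Bᶜ) (i := i) (Finset.mem_compl.2 hi) (by simp), mul_zero]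

/-- Markov's inequality for the number of successes. Strictness of `m < B.card` gives the factor m +
1, which also covers m = 0. -/
theorem sum_coinWeight_card {n : ℕ} {p q : ℝ≥0∞} (h : p + q = 1) (m : ℕ) :
    (∑ B : Finset (Fin n), if m < B.card then coinWeight p q B else 0) * (m + 1) ≤ n * p := by
  calc (∑ B : Finset (Fin n), if m < B.card then coinWeight p q B else 0) * (m + 1)
      ≤ ∑ B : Finset (Fin n), ∑ i : Fin n, (if i ∈ B then coinWeight p q B else 0) := by
        rw [Finset.sum_mul]
        refine Finset.sum_le_sum fun B _ => ?_
        rw [← Finset.sum_filter]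
        simp only [Finset.filter_univ_mem, Finset.sum_const, nsmul_eq_mul]
        split_ifs with hB
        · rw [mul_comm]
          gcongr
          exact_mod_cast hB
        · simp
    _ = n * p := by
        rw [Finset.sum_comm]
        simp_rw [sum_coinWeight_mem h]
        simp

theorem pi_mixture {n : ℕ} {Y : Type*} [MeasurableSpace Y] (μ ν : Fin n → Measure Y)
    [∀ i, IsProbabilityMeasure (μ i)] [∀ i, IsProbabilityMeasure (ν i)] {p q : ℝ≥0∞}
    (h : p + q = 1) :
    Measure.pi (fun i => p • μ i + q • ν i) =
      ∑ B : Finset (Fin n), coinWeight p q B • Measure.pi fun i => if i ∈ B then μ i else ν i := by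
  have hp : p ≠ ⊤ := ((h ▸ le_self_add : p ≤ 1).trans_lt ENNReal.one_lt_top).ne
  have hq : q ≠ ⊤ := ((h ▸ le_add_self : q ≤ 1).trans_lt ENNReal.one_lt_top).ne
  have h1 : ∀ i, IsFiniteMeasure (p • μ i) := fun i => Measure.smul_finite _ hp
  have h2 : ∀ i, IsFiniteMeasure (q • ν i) := fun i => Measure.smul_finite _ hq
  have h3 : ∀ (B : Finset (Fin n)) i, SigmaFinite (if i ∈ B then μ i else ν i) := fun B i => by
    split_ifs <;> infer_instance
  refine Measure.pi_eq fun s hs => ?_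
  simp only [Measure.coe_finsetSum, Finset.sum_apply, Measure.smul_apply, Measure.pi_pi,
    smul_eq_mul, Measure.coe_add, Pi.add_apply]
  rw [Fintype.prod_add]
  refine Finset.sum_congr rfl fun B _ => ?_
  unfold coinWeight
  rw [← Finset.prod_mul_prod_compl B (fun i => (if i ∈ B then μ i else ν i) (s i)),
    Finset.prod_mul_distrib, Finset.prod_mul_distrib,
    Finset.prod_congr rfl (fun i hi => by rw [if_pos hi] :
      ∀ i ∈ B, (if i ∈ B then μ i else ν i) (s i) = μ i (s i)),
    Finset.prod_congr rfl (fun i hi => by rw [if_neg (Finset.mem_compl.1 hi)] :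
      ∀ i ∈ Bᶜ, (if i ∈ B then μ i else ν i) (s i) = ν i (s i))]
  ring

/-! ### Output laws with the data integrated out. -/

/-- Independent inputs passed through separate channels give independent outputs; both sides agree
on boxes. -/
theorem pi_bind {n : ℕ} {X Y : Type*} [MeasurableSpace X] [MeasurableSpace Y]
    (ν : Fin n → Measure X) [∀ i, IsProbabilityMeasure (ν i)] (κ : Fin n → Kernel X Y)
    [∀ i, IsMarkovKernel (κ i)] {f : (Fin n → Y) → ℝ≥0∞} (hf : Measurable f) :
    ∫⁻ x, ∫⁻ y, f y ∂Measure.pi (fun i => κ i (x i)) ∂Measure.pi ν =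
      ∫⁻ y, f y ∂Measure.pi fun i => (ν i).bind (κ i) := by
  set K : Kernel (Fin n → X) (Fin n → Y) :=
    piKernel fun i => (κ i).comap (fun x => x i) (measurable_pi_apply i)
  have hK : ∀ x, K x = Measure.pi (fun i => κ i (x i)) := fun x => rfl
  have : Measure.pi (fun i => (ν i).bind (κ i)) = (Measure.pi ν).bind K := by
    refine Measure.pi_eq fun s hs => ?_
    rw [Measure.bind_apply (MeasurableSet.univ_pi hs) K.aemeasurable]
    simp_rw [hK, Measure.pi_pi]
    rw [lintegral_pi_prod ν (f := fun i x => κ i x (s i)) fun i => (κ i).measurable_coe (hs i)]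
    refine Finset.prod_congr rfl fun i _ => ?_
    rw [Measure.bind_apply (hs i) (κ i).aemeasurable]
  rw [this, Measure.lintegral_bind K.aemeasurable hf.aemeasurable]
  rfl

section mixFst

variable {X S Y : Type*} [MeasurableSpace X] [MeasurableSpace S] [MeasurableSpace Y]

/-- The law of `κ (x, s)` for `x` drawn from `P`, as a kernel in `s`. -/
noncomputable def mixFst (κ : Kernel (X × S) Y) (P : Measure X) : Kernel S Y :=
  κ ∘ₖ (Kernel.const S P ×ₖ Kernel.id)

instance (κ : Kernel (X × S) Y) [IsMarkovKernel κ] (P : Measure X) [IsProbabilityMeasure P] :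
    IsMarkovKernel (mixFst κ P) := by
  unfold mixFst; infer_instance

theorem lintegral_mixFst (κ : Kernel (X × S) Y) (P : Measure X) [IsProbabilityMeasure P]
    (s : S) {f : Y → ℝ≥0∞} (hf : Measurable f) :
    ∫⁻ y, f y ∂mixFst κ P s = ∫⁻ x, ∫⁻ y, f y ∂κ (x, s) ∂P := by
  unfold mixFst
  rw [Kernel.lintegral_comp _ _ _ hf, Kernel.prod_apply, Kernel.const_apply, Kernel.id_apply,
    lintegral_prod _ (hf.lintegral_kernel).aemeasurable]
  refine lintegral_congr fun x => ?_
  rw [lintegral_dirac']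
  exact hf.lintegral_kernel.comp measurable_prodMk_left

theorem mixFst_apply (κ : Kernel (X × S) Y) (P : Measure X) [IsProbabilityMeasure P]
    (s : S) {E : Set Y} (hE : MeasurableSet E) :
    mixFst κ P s E = ∫⁻ x, κ (x, s) E ∂P := by
  rw [← lintegral_indicator_one hE, lintegral_mixFst _ _ _ (measurable_one.indicator hE)]
  simp_rw [lintegral_indicator_one hE]

theorem mixFst_eq_bind (κ : Kernel (X × S) Y) (P : Measure X) [IsProbabilityMeasure P] (s : S) :
    mixFst κ P s = P.bind (κ.comap (fun x => (x, s)) (by fun_prop)) := by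
  ext E hE
  rw [mixFst_apply _ _ _ hE, Measure.bind_apply hE (Kernel.aemeasurable _)]
  rfl

end mixFst

namespace LocalProtocol

variable {X S Y Z : Type*} [MeasurableSpace X] [MeasurableSpace S]
    [MeasurableSpace Y] [MeasurableSpace Z] {m n : ℕ}

theorem lintegral_outputDist (Pr : LocalProtocol X S Y Z n) (P : Measure X)
    [IsProbabilityMeasure P] {f : Z → ℝ≥0∞} (hf : Measurable f) :
    ∫⁻ z, f z ∂Pr.outputDist P =
      ∫⁻ s, ∫⁻ y, ∫⁻ z, f z ∂Pr.agg (s, y) ∂Measure.pi (fun i => mixFst (Pr.rand i) P s) ∂Pr.pub := by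
  have hF : Measurable fun p : S × (Fin n → Y) => ∫⁻ z, f z ∂Pr.agg p := hf.lintegral_kernel
  unfold outputDist output
  rw [Measure.lintegral_bind (Kernel.aemeasurable _) hf.aemeasurable]
  simp_rw [Kernel.lintegral_comp _ _ _ hf, Kernel.lintegral_compProd _ _ _ hF, Kernel.const_apply]
  rw [lintegral_lintegral_swap]
  · refine lintegral_congr fun s => ?_
    simp_rw [mixFst_eq_bind]
    exact pi_bind (fun _ => P) (fun i => (Pr.rand i).comap (fun x => (x, s)) (by fun_prop))
      (hF.comp measurable_prodMk_left)
  · refine Measurable.aemeasurable ?_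
    have := Measurable.lintegral_kernel_prod_right (κ := Pr.messages)
      (f := fun (a : (Fin n → X) × S) y => ∫⁻ z, f z ∂Pr.agg (a.2, y))
      (hF.comp (by fun_prop : Measurable fun p : ((Fin n → X) × S) × (Fin n → Y) =>
        (p.1.2, p.2)))
    exact this

open Classical in
theorem lintegral_manipOutputDist (Pr : LocalProtocol X S Y Z n) (P : Measure X)
    [IsProbabilityMeasure P] (M : Attacker S Y m n) {f : Z → ℝ≥0∞} (hf : Measurable f) :
    ∫⁻ z, f z ∂Pr.manipOutputDist P M =
      ∫⁻ s, ∫⁻ a, ∫⁻ y, ∫⁻ z, f z ∂Pr.agg (s, y)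
        ∂Measure.pi (fun i => if i ∈ a.1 then Measure.dirac (a.2 i) else mixFst (Pr.rand i) P s)
        ∂M.strat s ∂Pr.pub := by
  have hF : Measurable fun p : S × (Fin n → Y) => ∫⁻ z, f z ∂Pr.agg p := hf.lintegral_kernel
  have hproj : Measurable fun p : (S × (Finset (Fin n) × (Fin n → Y))) × (Fin n → Y) =>
    (p.1.1, p.2) := by fun_prop
  unfold manipOutputDist manipOutput
  rw [Measure.lintegral_bind (Kernel.aemeasurable _) hf.aemeasurable]
  simp_rw [Kernel.lintegral_comp _ _ _ hf, Kernel.lintegral_map _ hproj _ hF]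
  have hG : Measurable fun p : (S × (Finset (Fin n) × (Fin n → Y))) × (Fin n → Y) =>
    ∫⁻ z, f z ∂Pr.agg (p.1.1, p.2) := hF.comp hproj
  have hH : Measurable fun p : (Fin n → X) × (S × (Finset (Fin n) × (Fin n → Y))) =>
      ∫⁻ y, ∫⁻ z, f z ∂Pr.agg (p.2.1, y) ∂piKernel Pr.manipMessage p :=
    Measurable.lintegral_kernel_prod_right (κ := piKernel Pr.manipMessage)
      (f := fun (p : (Fin n → X) × (S × (Finset (Fin n) × (Fin n → Y)))) y =>
        ∫⁻ z, f z ∂Pr.agg (p.2.1, y)) (hF.comp (by fun_prop : Measurable fun p :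
          ((Fin n → X) × (S × (Finset (Fin n) × (Fin n → Y)))) × (Fin n → Y) => (p.1.2.1, p.2)))
  simp_rw [Kernel.lintegral_compProd _ _ _ hG]
  have h1 : ∀ x : Fin n → X, ∫⁻ b, ∫⁻ c, ∫⁻ z, f z ∂Pr.agg (b.1, c) ∂piKernel Pr.manipMessage (x, b)
        ∂(Kernel.const (Fin n → X) Pr.pub ⊗ₖ M.strat.comap Prod.snd measurable_snd) x =
      ∫⁻ s, ∫⁻ a, ∫⁻ c, ∫⁻ z, f z ∂Pr.agg (s, c) ∂piKernel Pr.manipMessage (x, (s, a))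
        ∂M.strat s ∂Pr.pub := fun x => by
    exact Kernel.lintegral_compProd _ _ _ (hH.comp measurable_prodMk_left)
  simp_rw [h1]
  rw [lintegral_lintegral_swap]
  swap
  · refine Measurable.aemeasurable ?_
    exact Measurable.lintegral_kernel_prod_right
      (κ := M.strat.comap (Prod.snd : (Fin n → X) × S → S) measurable_snd)
      (f := fun (p : (Fin n → X) × S) a =>
        ∫⁻ c, ∫⁻ z, f z ∂Pr.agg (p.2, c) ∂piKernel Pr.manipMessage (p.1, (p.2, a)))
      (hH.comp (by fun_prop : Measurable fun p : ((Fin n → X) × S) ×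
        (Finset (Fin n) × (Fin n → Y)) => (p.1.1, (p.1.2, p.2))))
  refine lintegral_congr fun s => ?_
  -- The attacker does not see the data, so given `s` its move and the data are independent and can
  -- be integrated in either order.
  rw [lintegral_lintegral_swap]
  swap
  · exact (hH.comp (by fun_prop : Measurable fun p : (Fin n → X) ×
        (Finset (Fin n) × (Fin n → Y)) => (p.1, (s, p.2)))).aemeasurable
  refine lintegral_congr fun a => ?_
  let κ : Fin n → Kernel X Y := fun i => if i ∈ a.1 then Kernel.const X (Measure.dirac (a.2 i)) else
    (Pr.rand i).comap (fun x => (x, s)) (by fun_prop)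
  have hκ : ∀ i, IsMarkovKernel (κ i) := fun i => by
    simp only [κ]; split_ifs <;> infer_instance
  have hb : (fun i => if i ∈ a.1 then Measure.dirac (a.2 i) else mixFst (Pr.rand i) P s) =
      fun i => P.bind (κ i) := by
    funext i
    simp only [κ]
    split_ifs
    · ext E hE
      rw [Measure.bind_apply hE (Kernel.aemeasurable _)]
      simp
    · exact mixFst_eq_bind _ _ _
  rw [hb]
  refine Eq.trans (lintegral_congr fun x => ?_)
    (pi_bind (fun _ => P) κ (hF.comp (measurable_prodMk_left (x := s))))
  have : piKernel Pr.manipMessage (x, (s, a)) = Measure.pi (fun i => κ i (x i)) := by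
    change Measure.pi (fun i => Pr.manipMessage i (x, (s, a))) = _
    congr 1
    funext i
    unfold manipMessage
    rw [Kernel.piecewise_apply]
    simp only [κ, Set.mem_ofPred_eq]
    split_ifs <;> simp [Kernel.deterministic_apply]
  rw [this]

end LocalProtocol

/-! ### Simulating random corruption with exactly m users. -/

open Classical in
/-- The message `w i` if `i` lies in `C`, a fresh message with law `μ` otherwise. -/
noncomputable def replaceMessage {n : ℕ} {Y : Type*} [MeasurableSpace Y] (i : Fin n)
    (μ : Measure Y) : Kernel (Finset (Fin n) × (Fin n → Y)) Y :=
  Kernel.piecewise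
    (s := {a : Finset (Fin n) × (Fin n → Y) | i ∈ a.1})
    (measurable_fst (Set.toFinite {C : Finset (Fin n) | i ∈ C}).measurableSet)
    (Kernel.deterministic (fun a => a.2 i) (by fun_prop)) (Kernel.const _ μ)

instance {n : ℕ} {Y : Type*} [MeasurableSpace Y] (i : Fin n) (μ : Measure Y)
    [IsProbabilityMeasure μ] : IsMarkovKernel (replaceMessage i μ) := by
  unfold replaceMessage; infer_instance

/-- Messages that agree with `w` on `C` and are independent with laws `μ i` elsewhere. -/
noncomputable def replaceKernel {n : ℕ} {Y : Type*} [MeasurableSpace Y] (μ : Fin n → Measure Y)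
    [∀ i, IsProbabilityMeasure (μ i)] : Kernel (Finset (Fin n) × (Fin n → Y)) (Fin n → Y) :=
  piKernel fun i => replaceMessage i (μ i)

open Classical in
theorem replaceKernel_apply {n : ℕ} {Y : Type*} [MeasurableSpace Y] (μ : Fin n → Measure Y)
    [∀ i, IsProbabilityMeasure (μ i)] (a : Finset (Fin n) × (Fin n → Y)) :
    replaceKernel μ a = Measure.pi fun i => if i ∈ a.1 then Measure.dirac (a.2 i) else μ i := by
  have h : ∀ i, replaceMessage i (μ i) a =
      if i ∈ a.1 then Measure.dirac (a.2 i) else μ i := fun i => by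
    unfold replaceMessage
    rw [Kernel.piecewise_apply]
    simp only [Set.mem_ofPred_eq]
    split_ifs <;> simp [Kernel.deterministic_apply]
  simp_rw [← h]
  rfl

-- Only the coordinates of `w` in `C` are kept, and the others are redrawn, so averaging over `w`
-- leaves a product measure.
open Classical in
theorem lintegral_replaceKernel {n : ℕ} {Y : Type*} [MeasurableSpace Y] (μ ν : Fin n → Measure Y)
    [∀ i, IsProbabilityMeasure (μ i)] [∀ i, IsProbabilityMeasure (ν i)] (C : Finset (Fin n))
    {f : (Fin n → Y) → ℝ≥0∞} (hf : Measurable f) :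
    ∫⁻ w, ∫⁻ y, f y ∂replaceKernel μ (C, w) ∂Measure.pi ν =
      ∫⁻ y, f y ∂Measure.pi fun i => if i ∈ C then ν i else μ i := by
  let κ : Fin n → Kernel Y Y := fun i => if i ∈ C then Kernel.id else Kernel.const Y (μ i)
  have hκ : ∀ i, IsMarkovKernel (κ i) := fun i => by
    simp only [κ]; split_ifs <;> infer_instance
  have hb : (fun i => if i ∈ C then ν i else μ i) = fun i => (ν i).bind (κ i) := by
    funext i
    simp only [κ]
    split_ifs <;> simp
  rw [hb, ← pi_bind ν κ hf]
  refine lintegral_congr fun w => ?_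
  rw [replaceKernel_apply]
  congr 2
  funext i
  simp only [κ]
  split_ifs <;> simp [Kernel.id_apply]

/-- The attacker who draws a set `B` from `β`, corrupts `C B` and lets each user `i` send a message
from `κ i`. -/
noncomputable def Attacker.ofSample {S Y : Type*} [MeasurableSpace S] [MeasurableSpace Y] {m n : ℕ}
    (β : Measure (Finset (Fin n))) [IsProbabilityMeasure β]
    (κ : Fin n → Kernel (S × Finset (Fin n)) Y) [∀ i, IsMarkovKernel (κ i)]
    (C : Finset (Fin n) → Finset (Fin n)) (hC : ∀ B, (C B).card = m) : Attacker S Y m n where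
  strat := (Kernel.const S β ⊗ₖ piKernel κ).map fun p => (C p.1, p.2)
  strat_markov := Kernel.IsMarkovKernel.map _ (by fun_prop)
  card_eq s := by
    rw [Kernel.map_apply _ (by fun_prop)]
    refine (ae_map_iff (Measurable.aemeasurable (by fun_prop)) ?_).2 (ae_of_all _ fun p => hC p.1)
    exact measurable_fst (Set.toFinite {C : Finset (Fin n) | C.card = m}).measurableSet

/-- Pads the set of successful coins to the required size. If it is already too large, any set of
size m will do, because that event is charged to the error. -/
theorem exists_superset_card {n m : ℕ} (hm : m ≤ n) (B : Finset (Fin n)) :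
    ∃ C : Finset (Fin n), C.card = m ∧ (B.card ≤ m → B ⊆ C) := by
  by_cases h : B.card ≤ m
  · obtain ⟨C, hBC, hC⟩ := Finset.exists_superset_card_eq h (by simpa using hm)
    exact ⟨C, hC, fun _ => hBC⟩
  · obtain ⟨C, -, hC⟩ := Finset.exists_superset_card_eq (s := (∅ : Finset (Fin n))) (n := m)
      (by simp) (by simpa using hm)
    exact ⟨C, hC, fun h' => absurd h' h⟩

namespace LocalProtocol

variable {X S Y Z : Type*} [MeasurableSpace X] [MeasurableSpace S]
    [MeasurableSpace Y] [MeasurableSpace Z] {m n : ℕ}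

/-- Corrupting each user independently with probability `p` can be simulated with `m` corrupted
users, up to the probability that more than `m` coins succeed. -/
theorem exists_attacker (Pr : LocalProtocol X S Y Z n) (P : Measure X) [IsProbabilityMeasure P]
    (hm : m ≤ n) (q : Fin n → Kernel S Y) [∀ i, IsMarkovKernel (q i)] {p p' : ℝ≥0∞}
    (hp : p + p' = 1) :
    ∃ M : Attacker S Y m n, ∀ f : Z → ℝ≥0∞, Measurable f → (∀ z, f z ≤ 1) →
      ∫⁻ z, f z ∂Pr.manipOutputDist P M ≤
        ∫⁻ s, ∫⁻ y, ∫⁻ z, f z ∂Pr.agg (s, y)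
          ∂Measure.pi (fun i => p • q i s + p' • mixFst (Pr.rand i) P s) ∂Pr.pub +
        ∑ B : Finset (Fin n), if m < B.card then coinWeight p p' B else 0 := by
  classical
  choose C hCcard hBC using fun B => exists_superset_card hm B
  let β : Measure (Finset (Fin n)) := ∑ B, coinWeight p p' B • Measure.dirac B
  have hβ : IsProbabilityMeasure β := ⟨by
    simp only [β, Measure.coe_finsetSum, Finset.sum_apply, Measure.smul_apply, measure_univ,
      smul_eq_mul, mul_one]
    exact sum_coinWeight hp⟩
  -- Users corrupted only as padding, in `C B` but not in `B`, imitate an honest user by sampling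
  -- from the mixture over `P`.
  let κ : Fin n → Kernel (S × Finset (Fin n)) Y := fun i => Kernel.piecewise
    (s := {a : S × Finset (Fin n) | i ∈ a.2})
    (measurable_snd (Set.toFinite {C : Finset (Fin n) | i ∈ C}).measurableSet)
    ((q i).comap Prod.fst measurable_fst) ((mixFst (Pr.rand i) P).comap Prod.fst measurable_fst)
  have hκ : ∀ i, IsMarkovKernel (κ i) := fun i => by
    simp only [κ]; infer_instance
  have hκ' : ∀ i s B, κ i (s, B) = if i ∈ B then q i s else mixFst (Pr.rand i) P s := fun i s B => by
    simp only [κ, Kernel.piecewise_apply, Set.mem_ofPred_eq]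
    split_ifs <;> rfl
  refine ⟨Attacker.ofSample β κ C hCcard, fun f hf hf1 => ?_⟩
  rw [lintegral_manipOutputDist _ _ _ hf]
  have hF : Measurable fun p : S × (Fin n → Y) => ∫⁻ z, f z ∂Pr.agg p := hf.lintegral_kernel
  have hF1 : ∀ p, ∫⁻ z, f z ∂Pr.agg p ≤ 1 := fun p => by
    calc ∫⁻ z, f z ∂Pr.agg p ≤ ∫⁻ _, 1 ∂Pr.agg p := lintegral_mono hf1
      _ = 1 := by simp
  set δ := ∑ B : Finset (Fin n), if m < B.card then coinWeight p p' B else 0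
  have key : ∀ s, ∫⁻ a, ∫⁻ y, ∫⁻ z, f z ∂Pr.agg (s, y)
        ∂Measure.pi (fun i => if i ∈ a.1 then Measure.dirac (a.2 i) else mixFst (Pr.rand i) P s)
        ∂(Attacker.ofSample β κ C hCcard).strat s ≤
      ∫⁻ y, ∫⁻ z, f z ∂Pr.agg (s, y)
          ∂Measure.pi (fun i => p • q i s + p' • mixFst (Pr.rand i) P s) + δ := by
    intro s
    have hFs : Measurable fun y => ∫⁻ z, f z ∂Pr.agg (s, y) := hF.comp measurable_prodMk_left
    have hmap : Measurable fun p : Finset (Fin n) × (Fin n → Y) => (C p.1, p.2) := by fun_prop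
    have hR : Measurable fun a => ∫⁻ y, ∫⁻ z, f z ∂Pr.agg (s, y)
        ∂replaceKernel (fun i => mixFst (Pr.rand i) P s) a := hFs.lintegral_kernel
    simp_rw [← replaceKernel_apply (fun i => mixFst (Pr.rand i) P s)]
    change ∫⁻ a, _ ∂(Kernel.const S β ⊗ₖ piKernel κ).map _ s ≤ _
    have hcp := Kernel.lintegral_compProd (Kernel.const S β) (piKernel κ) s (hR.comp hmap)
    simp only [Function.comp_apply] at hcp
    rw [Kernel.lintegral_map _ hmap _ hR, hcp, Kernel.const_apply, lintegral_finsetSum_measure]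
    simp_rw [lintegral_smul_measure, lintegral_dirac]
    have h1 : ∀ B, ∫⁻ w, ∫⁻ y, ∫⁻ z, f z ∂Pr.agg (s, y)
        ∂replaceKernel (fun i => mixFst (Pr.rand i) P s) (C B, w) ∂piKernel κ (s, B) =
        ∫⁻ y, ∫⁻ z, f z ∂Pr.agg (s, y)
          ∂Measure.pi fun i => if i ∈ C B then κ i (s, B) else mixFst (Pr.rand i) P s := fun B =>
      lintegral_replaceKernel (fun i => mixFst (Pr.rand i) P s) (fun i => κ i (s, B)) (C B) hFs
    simp_rw [h1]
    rw [pi_mixture (fun i => q i s) (fun i => mixFst (Pr.rand i) P s) hp, lintegral_finsetSum_measure,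
      ← Finset.sum_add_distrib]
    refine Finset.sum_le_sum fun B _ => ?_
    rw [lintegral_smul_measure, smul_eq_mul, smul_eq_mul]
    split_ifs with hB
    · refine le_trans ?_ le_add_self
      calc coinWeight p p' B * _ ≤ coinWeight p p' B * 1 := by
            gcongr
            have : ∀ i, IsProbabilityMeasure
                (if i ∈ C B then κ i (s, B) else mixFst (Pr.rand i) P s) := fun i => by
              split_ifs <;> infer_instance
            refine (lintegral_mono fun y => hF1 (s, y)).trans ?_
            simp
        _ = _ := mul_one _
    · rw [add_zero]
      refine le_of_eq ?_
      congr 3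
      funext i
      rw [hκ']
      have := hBC B (not_lt.1 hB)
      by_cases hi : i ∈ B
      · simp [hi, this hi]
      · simp [hi]
  calc _ ≤ ∫⁻ s, (∫⁻ y, ∫⁻ z, f z ∂Pr.agg (s, y)
          ∂Measure.pi (fun i => p • q i s + p' • mixFst (Pr.rand i) P s) + δ) ∂Pr.pub :=
        lintegral_mono key
    _ = _ := by
        rw [lintegral_add_right _ measurable_const]
        simp

end LocalProtocol

/-! ### Random paired signs and sub-Gaussian estimates. -/

/-- The sign `±1` encoded by a Boolean. -/
noncomputable def boolSign (b : Bool) : ℝ := if b then 1 else -1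

theorem abs_boolSign (b : Bool) : |boolSign b| = 1 := by
  cases b <;> simp [boolSign]

/-- Opposite signs on the two elements of each of the pairs `{0, 1}, {2, 3}, …`, chosen by `σ`; an
unpaired last element gets `0`. -/
noncomputable def pairSign {d : ℕ} (σ : Fin (d / 2) → Bool) (j : Fin d) : ℝ :=
  if h : (j : ℕ) / 2 < d / 2 then (if (j : ℕ) % 2 = 0 then 1 else -1) * boolSign (σ ⟨j / 2, h⟩)
  else 0

theorem abs_pairSign {d : ℕ} (σ : Fin (d / 2) → Bool) (j : Fin d) :
    |pairSign σ j| = if (j : ℕ) / 2 < d / 2 then 1 else 0 := by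
  unfold pairSign
  split_ifs <;> simp [abs_boolSign]

theorem abs_pairSign_le {d : ℕ} (σ : Fin (d / 2) → Bool) (j : Fin d) : |pairSign σ j| ≤ 1 := by
  rw [abs_pairSign]; split_ifs <;> norm_num

theorem sum_range_two_mul {M : Type*} [AddCommMonoid M] (F : ℕ → M) (k : ℕ) :
    ∑ j ∈ Finset.range (2 * k), F j = ∑ i ∈ Finset.range k, (F (2 * i) + F (2 * i + 1)) := by
  induction k with
  | zero => simp
  | succ k ih =>
    rw [Finset.sum_range_succ, ← ih, mul_add, mul_one, Finset.sum_range_succ,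
      Finset.sum_range_succ, add_assoc]

theorem sum_fin_eq_sum_pairs {d : ℕ} (F : Fin d → ℝ)
    (hF : ∀ j : Fin d, ¬ (j : ℕ) / 2 < d / 2 → F j = 0) :
    ∑ j, F j = ∑ i : Fin (d / 2), (F ⟨2 * i, by omega⟩ + F ⟨2 * i + 1, by omega⟩) := by
  let G : ℕ → ℝ := fun j => if h : j < d then F ⟨j, h⟩ else 0
  have h1 : ∑ j, F j = ∑ j ∈ Finset.range d, G j := by
    rw [← Fin.sum_univ_eq_sum_range]
    exact Finset.sum_congr rfl fun j _ => by simp [G]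
  have h2 : ∑ j ∈ Finset.range d, G j = ∑ j ∈ Finset.range (2 * (d / 2)), G j := by
    symm
    refine Finset.sum_subset (Finset.range_mono (by omega)) fun j hj hj' => ?_
    simp only [Finset.mem_range] at hj hj'
    simp only [G, hj, dif_pos]
    exact hF _ (by simp only; omega)
  rw [h1, h2, sum_range_two_mul,
    ← Fin.sum_univ_eq_sum_range (fun i => G (2 * i) + G (2 * i + 1))]
  refine Finset.sum_congr rfl fun i _ => ?_
  have h3 : 2 * (i : ℕ) < d := by omega
  have h4 : 2 * (i : ℕ) + 1 < d := by omega
  simp [G, h3, h4]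

theorem sum_pairSign_mul {d : ℕ} (σ : Fin (d / 2) → Bool) (r : Fin d → ℝ) :
    ∑ j, pairSign σ j * r j = ∑ i : Fin (d / 2),
      boolSign (σ i) * (r ⟨2 * i, by omega⟩ - r ⟨2 * i + 1, by omega⟩) := by
  rw [sum_fin_eq_sum_pairs _ fun j hj => by rw [pairSign, dif_neg hj, zero_mul]]
  refine Finset.sum_congr rfl fun i _ => ?_
  have h1 : (2 * (i : ℕ)) / 2 = i := by omega
  have h2 : (2 * (i : ℕ) + 1) / 2 = i := by omega
  have h3 : (2 * (i : ℕ) + 1) % 2 = 1 := by omega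
  have h4 : (2 * (i : ℕ)) % 2 = 0 := by omega
  simp only [pairSign, h1, h2, h3, h4, i.2, dif_pos, if_true, one_ne_zero, if_false]
  ring

/-- The purpose of the pairing: the signs cancel for every `σ`, so every skewed law has total mass 1
and yet the pairs carry independent signs. -/
theorem sum_pairSign {d : ℕ} (σ : Fin (d / 2) → Bool) : ∑ j, pairSign σ j = 0 := by
  simpa using sum_pairSign_mul σ fun _ => 1

theorem sum_abs_pairSign {d : ℕ} (σ : Fin (d / 2) → Bool) :
    ∑ j, |pairSign σ j| = 2 * (d / 2 : ℕ) := by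
  rw [sum_fin_eq_sum_pairs _ fun j hj => by rw [pairSign, dif_neg hj, abs_zero]]
  have h1 : ∀ i : Fin (d / 2), (2 * (i : ℕ)) / 2 < d / 2 := fun i => by omega
  have h2 : ∀ i : Fin (d / 2), (2 * (i : ℕ) + 1) / 2 < d / 2 := fun i => by omega
  simp only [abs_pairSign, h1, h2, if_true, Finset.sum_const, Finset.card_univ, Fintype.card_fin,
    nsmul_eq_mul]
  ring

/-- The sum over signs factorizes into hyperbolic cosines, and cosh b ≤ exp(b²/2). -/
theorem sum_exp_sum_boolSign_le {k : ℕ} (b : Fin k → ℝ) :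
    ∑ σ : Fin k → Bool, Real.exp (∑ i, boolSign (σ i) * b i) ≤
      Fintype.card (Fin k → Bool) * Real.exp ((∑ i, b i ^ 2) / 2) := by
  have h := Finset.prod_univ_sum (fun _ : Fin k => (Finset.univ : Finset Bool))
    (fun i c => Real.exp (boolSign c * b i))
  rw [Fintype.piFinset_univ] at h
  simp_rw [Real.exp_sum]
  rw [← h, Finset.sum_div, Real.exp_sum]
  have hc : ((Fintype.card (Fin k → Bool) : ℕ) : ℝ) = ∏ _i : Fin k, (2 : ℝ) := by simp
  rw [hc, ← Finset.prod_mul_distrib]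
  refine Finset.prod_le_prod (fun i _ => by positivity) fun i _ => ?_
  have := Real.cosh_le_exp_half_sq (b i)
  rw [Real.cosh_eq] at this
  simp only [Fintype.sum_bool, boolSign, if_true, one_mul, Bool.false_eq_true, if_false, neg_mul]
  linarith

/-- Chernoff's bound with the optimal parameter `t / V`, applied to both signs of `G`. -/
theorem card_lt_abs_le_of_mgf {Ω : Type*} [Fintype Ω] (G : Ω → ℝ) {V : ℝ} (hV : 0 < V)
    (hG : ∀ l : ℝ, ∑ ω, Real.exp (l * G ω) ≤ Fintype.card Ω * Real.exp (l ^ 2 * V / 2))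
    {t : ℝ} (ht : 0 ≤ t) :
    ∑ ω, (if t < |G ω| then (1 : ℝ) else 0) ≤
      Fintype.card Ω * (2 * Real.exp (-(t ^ 2 / (2 * V)))) := by
  have h1 := hG (t / V)
  have h2 := hG (-(t / V))
  have hle : ∀ ω, (if t < |G ω| then (1 : ℝ) else 0) ≤
      Real.exp (-(t ^ 2 / V)) * (Real.exp (t / V * G ω) + Real.exp (-(t / V) * G ω)) := by
    intro ω
    split_ifs with h
    · rw [mul_add, ← Real.exp_add, ← Real.exp_add]
      have hpos : ∀ x : ℝ, t < x → 1 ≤ Real.exp (-(t ^ 2 / V) + t / V * x) := fun x hx => by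
        rw [Real.one_le_exp_iff]
        have : -(t ^ 2 / V) + t / V * x = t / V * (x - t) := by field_simp; ring
        rw [this]
        exact mul_nonneg (by positivity) (by linarith)
      rcases lt_abs.1 h with h | h
      · linarith [hpos _ h, Real.exp_pos (-(t ^ 2 / V) + -(t / V) * G ω)]
      · have := hpos _ h
        rw [mul_neg, ← neg_mul] at this
        linarith [Real.exp_pos (-(t ^ 2 / V) + t / V * G ω)]
    · positivity
  have he : Real.exp (-(t ^ 2 / V)) * Real.exp ((t / V) ^ 2 * V / 2) =
      Real.exp (-(t ^ 2 / (2 * V))) := by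
    rw [← Real.exp_add]; congr 1; field_simp; ring
  calc _ ≤ ∑ ω, Real.exp (-(t ^ 2 / V)) *
        (Real.exp (t / V * G ω) + Real.exp (-(t / V) * G ω)) := Finset.sum_le_sum fun ω _ => hle ω
    _ = Real.exp (-(t ^ 2 / V)) *
        (∑ ω, Real.exp (t / V * G ω) + ∑ ω, Real.exp (-(t / V) * G ω)) := by
        rw [← Finset.mul_sum, Finset.sum_add_distrib]
    _ ≤ Real.exp (-(t ^ 2 / V)) * (Fintype.card Ω * Real.exp ((t / V) ^ 2 * V / 2) +
        Fintype.card Ω * Real.exp ((t / V) ^ 2 * V / 2)) := by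
        rw [neg_sq] at h2
        gcongr
    _ = Fintype.card Ω * (2 * (Real.exp (-(t ^ 2 / V)) * Real.exp ((t / V) ^ 2 * V / 2))) := by
        ring
    _ = _ := by rw [he]

/-- Uses x²/2 ≤ exp x + exp(-x) at x = G/√V; the constant 8 is not optimized. -/
theorem sum_sq_le_of_mgf {Ω : Type*} [Fintype Ω] (G : Ω → ℝ) {V : ℝ} (hV : 0 < V)
    (hG : ∀ l : ℝ, ∑ ω, Real.exp (l * G ω) ≤ Fintype.card Ω * Real.exp (l ^ 2 * V / 2)) :
    ∑ ω, G ω ^ 2 ≤ Fintype.card Ω * (8 * V) := by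
  set l := 1 / √V
  have hl : l ^ 2 * V = 1 := by
    simp only [l, div_pow, Real.sq_sqrt hV.le, one_pow]; field_simp
  have h1 := hG l
  have h2 := hG (-l)
  rw [neg_sq] at h2
  rw [hl] at h1 h2
  have he : Real.exp (1 / 2) ≤ 2 := by
    have h : Real.exp (1 / 2) ^ 2 ≤ 2 ^ 2 := by
      rw [← Real.exp_nat_mul]
      norm_num
      linarith [Real.exp_one_lt_d9]
    exact le_of_sq_le_sq h (by norm_num)
  have hle : ∀ ω, G ω ^ 2 ≤ 2 * V * (Real.exp (l * G ω) + Real.exp (-l * G ω)) := by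
    intro ω
    have hx : ∀ x : ℝ, x ^ 2 / 2 ≤ Real.exp x + Real.exp (-x) := fun x => by
      rcases le_total 0 x with h | h
      · linarith [Real.quadratic_le_exp_of_nonneg h, Real.exp_pos (-x)]
      · have := Real.quadratic_le_exp_of_nonneg (neg_nonneg.2 h)
        rw [neg_sq] at this
        linarith [Real.exp_pos x]
    have := hx (l * G ω)
    rw [mul_pow, ← neg_mul] at this
    calc G ω ^ 2 = 2 * V * (l ^ 2 * G ω ^ 2 / 2) := by
          rw [show 2 * V * (l ^ 2 * G ω ^ 2 / 2) = l ^ 2 * V * G ω ^ 2 by ring, hl, one_mul]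
      _ ≤ _ := by gcongr
  have hN : (0 : ℝ) ≤ Fintype.card Ω := Nat.cast_nonneg _
  calc _ ≤ ∑ ω, 2 * V * (Real.exp (l * G ω) + Real.exp (-l * G ω)) :=
        Finset.sum_le_sum fun ω _ => hle ω
    _ = 2 * V * (∑ ω, Real.exp (l * G ω) + ∑ ω, Real.exp (-l * G ω)) := by
        rw [← Finset.mul_sum, Finset.sum_add_distrib]
    _ ≤ 2 * V * (Fintype.card Ω * 2 + Fintype.card Ω * 2) := by
        have : (Fintype.card Ω : ℝ) * Real.exp (1 / 2) ≤ Fintype.card Ω * 2 := by gcongr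
        gcongr <;> linarith
    _ = _ := by ring

/-! ### Skewed distributions near the uniform one. -/

theorem sum_skewed {d : ℕ} [NeZero d] (σ : Fin (d / 2) → Bool) (a : ℝ) :
    ∑ j, (1 + a * pairSign σ j) / d = 1 := by
  have : (d : ℝ) ≠ 0 := Nat.cast_ne_zero.2 (NeZero.ne d)
  rw [← Finset.sum_div, Finset.sum_add_distrib, ← Finset.mul_sum, sum_pairSign]
  simp [this]

theorem skewed_nonneg {d : ℕ} (σ : Fin (d / 2) → Bool) {a : ℝ} (ha : |a| ≤ 1) (j : Fin d) :
    0 ≤ (1 + a * pairSign σ j) / d := by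
  have : |a * pairSign σ j| ≤ 1 := by
    rw [abs_mul]; exact mul_le_one₀ ha (abs_nonneg _) (abs_pairSign_le σ j)
  have := neg_le_of_abs_le this
  have h : 0 ≤ 1 + a * pairSign σ j := by linarith
  positivity

/-- The uniform distribution skewed by `a` in the direction of the signs `pairSign σ`. -/
noncomputable def skewedPMF {d : ℕ} [NeZero d] (σ : Fin (d / 2) → Bool) (a : ℝ) (ha : |a| ≤ 1) :
    PMF (Fin d) :=
  PMF.ofFintype (fun j => ENNReal.ofReal ((1 + a * pairSign σ j) / d)) (by
    rw [← ENNReal.ofReal_sum_of_nonneg fun j _ => skewed_nonneg σ ha j, sum_skewed,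
      ENNReal.ofReal_one])

theorem skewedPMF_toReal {d : ℕ} [NeZero d] (σ : Fin (d / 2) → Bool) (a : ℝ) (ha : |a| ≤ 1)
    (j : Fin d) : (skewedPMF σ a ha j).toReal = (1 + a * pairSign σ j) / d := by
  rw [skewedPMF, PMF.ofFintype_apply, ENNReal.toReal_ofReal (skewed_nonneg σ ha j)]

theorem uniform_toReal {d : ℕ} [NeZero d] (j : Fin d) :
    (PMF.uniformOfFintype (Fin d) j).toReal = 1 / d := by
  simp

theorem l1Dist_uniform_skewedPMF {d : ℕ} [NeZero d] (σ : Fin (d / 2) → Bool) {a : ℝ} (h0 : 0 ≤ a)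
    (ha : |a| ≤ 1) :
    l1Dist (PMF.uniformOfFintype (Fin d)) (skewedPMF σ a ha) = a * (2 * (d / 2 : ℕ) / d) := by
  unfold l1Dist
  have hd : (0 : ℝ) < d := Nat.cast_pos.2 (NeZero.pos d)
  have : ∀ j, |(PMF.uniformOfFintype (Fin d) j).toReal - (skewedPMF σ a ha j).toReal| =
      a / d * |pairSign σ j| := fun j => by
    rw [uniform_toReal, skewedPMF_toReal, ← sub_div,
      show 1 - (1 + a * pairSign σ j) = -(a * pairSign σ j) by ring, abs_div, abs_neg, abs_mul,
      abs_of_nonneg h0, abs_of_pos hd]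
    ring
  simp_rw [this]
  rw [← Finset.mul_sum, sum_abs_pairSign]
  ring

theorem l1Dist_uniform_skewedPMF_bounds {d : ℕ} [NeZero d] (hd : 2 ≤ d) (σ : Fin (d / 2) → Bool)
    {a : ℝ} (h0 : 0 ≤ a) (ha : |a| ≤ 1) :
    2 / 3 * a ≤ l1Dist (PMF.uniformOfFintype (Fin d)) (skewedPMF σ a ha) ∧
      l1Dist (PMF.uniformOfFintype (Fin d)) (skewedPMF σ a ha) ≤ a := by
  rw [l1Dist_uniform_skewedPMF σ h0 ha]
  have hd0 : (0 : ℝ) < d := Nat.cast_pos.2 (NeZero.pos d)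
  -- An odd `d` leaves one element unskewed; the worst case is d = 3.
  have h1 : (2 : ℝ) / 3 ≤ 2 * (d / 2 : ℕ) / d := by
    rw [div_le_div_iff₀ (by norm_num) hd0]
    exact_mod_cast (by omega : 2 * d ≤ 2 * (d / 2) * 3)
  have h2 : 2 * ((d / 2 : ℕ) : ℝ) / d ≤ 1 := by
    rw [div_le_one hd0]
    exact_mod_cast (by omega : 2 * (d / 2) ≤ d)
  constructor
  · rw [mul_comm]; gcongr
  · exact mul_le_of_le_one_right h0 h2

/-! ### Message densities under skewed data. -/

section deviation

variable {S Y : Type*} [MeasurableSpace S] [MeasurableSpace Y] {d : ℕ}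

/-- The uniform distribution on `{1, …, d}` as a measure. -/
noncomputable abbrev unifMeasure (d : ℕ) [NeZero d] : Measure (Fin d) :=
  (PMF.uniformOfFintype (Fin d)).toMeasure

theorem mixFst_real (κ : Kernel (Fin d × S) Y) [IsMarkovKernel κ] (P : PMF (Fin d)) (s : S)
    {E : Set Y} (hE : MeasurableSet E) :
    (mixFst κ P.toMeasure s).real E = ∑ j, (P j).toReal * (κ (j, s)).real E := by
  rw [measureReal_def, mixFst_apply _ _ _ hE, lintegral_fintype, ENNReal.toReal_sum]
  · refine Finset.sum_congr rfl fun j _ => ?_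
    rw [PMF.toMeasure_apply_singleton _ _ (measurableSet_singleton j), ENNReal.toReal_mul, mul_comm]
    rfl
  · intro j _
    exact ENNReal.mul_ne_top (measure_ne_top _ _) (measure_ne_top _ _)

variable [NeZero d]

theorem mixFst_unif_real (κ : Kernel (Fin d × S) Y) [IsMarkovKernel κ] (s : S)
    {E : Set Y} (hE : MeasurableSet E) :
    (mixFst κ (unifMeasure d) s).real E = (∑ j, (κ (j, s)).real E) / d := by
  rw [mixFst_real κ _ s hE, Finset.sum_div]
  refine Finset.sum_congr rfl fun j _ => ?_
  rw [uniform_toReal]; ring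

variable [MeasurableSpace.CountablyGenerated Y]

/-- The density of `κ (j, s)` with respect to the uniform mixture of the laws `κ (·, s)`, minus
`1` and clamped to `[-δ, δ]`. -/
noncomputable def deviation (κ : Kernel (Fin d × S) Y) (δ : ℝ) (j : Fin d) (s : S) (y : Y) : ℝ :=
  max (-δ) (min δ
    (((κ.comap (fun s => (j, s)) (by fun_prop)).rnDeriv (mixFst κ (unifMeasure d)) s y).toReal - 1))

theorem measurable_deviation (κ : Kernel (Fin d × S) Y) (δ : ℝ) (j : Fin d) :
    Measurable fun p : S × Y => deviation κ δ j p.1 p.2 :=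
  measurable_const.max (measurable_const.min
    ((Kernel.measurable_rnDeriv _ _).ennreal_toReal.sub_const 1))

/-- Thanks to the clamp this holds at every message, not just almost everywhere. The averages over
signs at a fixed message, and the union bound over a finite message space, rely on that. -/
theorem abs_deviation_le (κ : Kernel (Fin d × S) Y) {δ : ℝ} (hδ : 0 ≤ δ) (j : Fin d) (s : S)
    (y : Y) : |deviation κ δ j s y| ≤ δ :=
  abs_le.2 ⟨le_max_left _ _, max_le (by linarith) (min_le_left _ _)⟩

/-- `ε`-local differential privacy of a single randomizer. -/
def KernelLDP (κ : Kernel (Fin d × S) Y) (ε : ℝ) : Prop :=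
  ∀ (x x' : Fin d) (s : S) (E : Set Y), MeasurableSet E →
    κ (x, s) E ≤ ENNReal.ofReal (Real.exp ε) * κ (x', s) E

/-- Averaging the privacy inequality over one of its two inputs puts the density against the uniform
mixture between exp(-ε) and exp ε almost everywhere, so there the clamp is inactive. -/
theorem setIntegral_deviation {κ : Kernel (Fin d × S) Y} [IsMarkovKernel κ] {ε δ : ℝ}
    (h : KernelLDP κ ε) (hδ : Real.exp ε - 1 ≤ δ) (j : Fin d) (s : S)
    {E : Set Y} (hE : MeasurableSet E) :
    ∫ y in E, deviation κ δ j s y ∂mixFst κ (unifMeasure d) s =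
      (κ (j, s)).real E - (mixFst κ (unifMeasure d) s).real E := by
  set μ := mixFst κ (unifMeasure d)
  set κj : Kernel S Y := κ.comap (fun s => (j, s)) (by fun_prop) with hκj
  have hκjs : κj s = κ (j, s) := rfl
  set c := ENNReal.ofReal (Real.exp ε)
  have h1 : ∀ E, MeasurableSet E → κ (j, s) E ≤ c * μ s E := fun E hE => by
    calc κ (j, s) E = ∫⁻ _, κ (j, s) E ∂unifMeasure d := by simp
      _ ≤ ∫⁻ x, c * κ (x, s) E ∂unifMeasure d := lintegral_mono fun x => h j x s E hE
      _ = c * μ s E := by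
        rw [lintegral_const_mul _ (measurable_of_finite _), mixFst_apply _ _ _ hE]
  have h2 : ∀ E, MeasurableSet E → μ s E ≤ c * κ (j, s) E := fun E hE => by
    calc μ s E = ∫⁻ x, κ (x, s) E ∂unifMeasure d := mixFst_apply _ _ _ hE
      _ ≤ ∫⁻ _, c * κ (j, s) E ∂unifMeasure d := lintegral_mono fun x => h x j s E hE
      _ = c * κ (j, s) E := by simp
  have hac : κj s ≪ μ s := Measure.AbsolutelyContinuous.mk fun E hE hE0 => by
    have := h1 E hE
    rw [hE0, mul_zero] at this
    exact le_antisymm this bot_le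
  have hwd : (μ s).withDensity (κj.rnDeriv μ s) = κj s := by
    rw [← Kernel.withDensity_rnDeriv_eq hac, Kernel.withDensity_apply]
    exact Kernel.measurable_rnDeriv _ _
  have hset : ∀ E, MeasurableSet E → ∫⁻ y in E, κj.rnDeriv μ s y ∂μ s = κ (j, s) E :=
    fun E hE => by rw [← withDensity_apply _ hE, hwd, hκjs]
  have hm : Measurable (κj.rnDeriv μ s) := Kernel.measurable_rnDeriv_right _ _ _
  have hup : κj.rnDeriv μ s ≤ᵐ[μ s] fun _ => c :=
    ae_le_of_forall_setLIntegral_le_of_sigmaFinite hm fun E hE _ => by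
      rw [hset E hE, setLIntegral_const]; exact h1 E hE
  have hlow : (fun _ => (1 : ℝ≥0∞)) ≤ᵐ[μ s] fun y => c * κj.rnDeriv μ s y :=
    ae_le_of_forall_setLIntegral_le_of_sigmaFinite measurable_const fun E hE _ => by
      rw [lintegral_const_mul _ hm, hset E hE, setLIntegral_const, one_mul]; exact h2 E hE
  have hdev : deviation κ δ j s =ᵐ[μ s] fun y => (κj.rnDeriv μ s y).toReal - 1 := by
    filter_upwards [hup, hlow] with y hy1 hy2
    have hfin : κj.rnDeriv μ s y ≠ ⊤ := (hy1.trans_lt ENNReal.ofReal_lt_top).ne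
    have hr1 : (κj.rnDeriv μ s y).toReal ≤ Real.exp ε :=
      ENNReal.toReal_le_of_le_ofReal (Real.exp_pos _).le hy1
    have hr2 : 1 ≤ Real.exp ε * (κj.rnDeriv μ s y).toReal := by
      have := ENNReal.toReal_mono (ENNReal.mul_ne_top ENNReal.ofReal_ne_top hfin) hy2
      rwa [ENNReal.toReal_one, ENNReal.toReal_mul, ENNReal.toReal_ofReal (Real.exp_pos _).le]
        at this
    set r := (κj.rnDeriv μ s y).toReal
    -- Here r ≥ exp(-ε), and 1 - exp(-ε) ≤ exp ε - 1.
    have hlow' : -δ ≤ r - 1 := by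
      have he := Real.exp_pos ε
      nlinarith [sq_nonneg (Real.exp ε - 1)]
    change max (-δ) (min δ (r - 1)) = r - 1
    rw [min_eq_right (by linarith), max_eq_right hlow']
  have hint : Integrable (fun y => (κj.rnDeriv μ s y).toReal) (μ s) := by
    refine integrable_toReal_of_lintegral_ne_top hm.aemeasurable ?_
    rw [← setLIntegral_univ, hset _ MeasurableSet.univ]
    exact measure_ne_top _ _
  rw [integral_congr_ae (ae_restrict_of_ae hdev), integral_sub hint.integrableOn
    (integrable_const _), integral_toReal hm.aemeasurable
      (ae_restrict_of_ae (hup.mono fun y hy => hy.trans_lt ENNReal.ofReal_lt_top)), hset E hE]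
  simp [measureReal_def]

/-- The density of `κ (·, s)`, applied to data skewed in the direction `σ`, with respect to the
uniform mixture is `1 + a * tilt`, where `a` is the strength of the skew. -/
noncomputable def tilt (κ : Kernel (Fin d × S) Y) (δ : ℝ) (σ : Fin (d / 2) → Bool) (s : S) (y : Y) :
    ℝ :=
  (∑ j, pairSign σ j * deviation κ δ j s y) / d

theorem measurable_tilt (κ : Kernel (Fin d × S) Y) (δ : ℝ) (σ : Fin (d / 2) → Bool) :
    Measurable fun p : S × Y => tilt κ δ σ p.1 p.2 :=
  (Finset.measurable_fun_sum _ fun j _ => (measurable_deviation κ δ j).const_mul _).div_const _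

theorem abs_tilt_le (κ : Kernel (Fin d × S) Y) {δ : ℝ} (hδ : 0 ≤ δ) (σ : Fin (d / 2) → Bool)
    (s : S) (y : Y) : |tilt κ δ σ s y| ≤ δ := by
  have hd : (0 : ℝ) < d := Nat.cast_pos.2 (NeZero.pos d)
  unfold tilt
  rw [abs_div, abs_of_pos hd, div_le_iff₀ hd]
  calc |∑ j, pairSign σ j * deviation κ δ j s y| ≤ ∑ j : Fin d, δ :=
        (Finset.abs_sum_le_sum_abs _ _).trans (Finset.sum_le_sum fun j _ => by
          rw [abs_mul]
          calc _ ≤ 1 * δ := mul_le_mul (abs_pairSign_le σ j) (abs_deviation_le κ hδ j s y)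
                (abs_nonneg _) zero_le_one
            _ = δ := one_mul _)
    _ = δ * d := by simp [mul_comm]

theorem integrable_deviation (κ : Kernel (Fin d × S) Y) {δ : ℝ} (hδ : 0 ≤ δ)
    (j : Fin d) (s : S) (μ : Measure Y) [IsFiniteMeasure μ] :
    Integrable (deviation κ δ j s) μ :=
  Integrable.of_bound ((measurable_deviation κ δ j).comp measurable_prodMk_left).aestronglyMeasurable
    δ (ae_of_all _ (abs_deviation_le κ hδ j s))

theorem integrable_tilt (κ : Kernel (Fin d × S) Y) {δ : ℝ} (hδ : 0 ≤ δ)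
    (σ : Fin (d / 2) → Bool) (s : S) (μ : Measure Y) [IsFiniteMeasure μ] :
    Integrable (tilt κ δ σ s) μ :=
  Integrable.of_bound ((measurable_tilt κ δ σ).comp measurable_prodMk_left).aestronglyMeasurable
    δ (ae_of_all _ (abs_tilt_le κ hδ σ s))

theorem setIntegral_tilt {κ : Kernel (Fin d × S) Y} [IsMarkovKernel κ] {ε δ : ℝ}
    (h : KernelLDP κ ε) (hδ0 : 0 ≤ δ) (hδ : Real.exp ε - 1 ≤ δ) (σ : Fin (d / 2) → Bool) (s : S)
    {E : Set Y} (hE : MeasurableSet E) :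
    ∫ y in E, tilt κ δ σ s y ∂mixFst κ (unifMeasure d) s =
      (∑ j, pairSign σ j * (κ (j, s)).real E) / d := by
  unfold tilt
  rw [integral_div, integral_finsetSum _ fun j _ =>
    (integrable_deviation κ hδ0 j s _).const_mul _]
  simp_rw [integral_const_mul, setIntegral_deviation h hδ _ s hE, mul_sub]
  rw [Finset.sum_sub_distrib, ← Finset.sum_mul, sum_pairSign, zero_mul, sub_zero]

theorem integral_tilt {κ : Kernel (Fin d × S) Y} [IsMarkovKernel κ] {ε δ : ℝ}
    (h : KernelLDP κ ε) (hδ0 : 0 ≤ δ) (hδ : Real.exp ε - 1 ≤ δ) (σ : Fin (d / 2) → Bool) (s : S) :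
    ∫ y, tilt κ δ σ s y ∂mixFst κ (unifMeasure d) s = 0 := by
  rw [← setIntegral_univ, setIntegral_tilt h hδ0 hδ σ s MeasurableSet.univ]
  simp [sum_pairSign]

/-- The message law is linear in the data law, and the signs sum to zero, so the reference part of
each deviation cancels. `haδ` keeps the density nonnegative, so that `ENNReal.ofReal` does not
truncate. -/
theorem mixFst_skewedPMF {κ : Kernel (Fin d × S) Y} [IsMarkovKernel κ] {ε δ : ℝ}
    (h : KernelLDP κ ε) (hδ0 : 0 ≤ δ) (hδ : Real.exp ε - 1 ≤ δ) (σ : Fin (d / 2) → Bool) (s : S)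
    {a : ℝ} (ha : |a| ≤ 1) (haδ : |a| * δ ≤ 1) :
    mixFst κ (skewedPMF σ a ha).toMeasure s =
      (mixFst κ (unifMeasure d) s).withDensity fun y => ENNReal.ofReal (1 + a * tilt κ δ σ s y) := by
  ext E hE
  have hnn : ∀ y, 0 ≤ 1 + a * tilt κ δ σ s y := fun y => by
    have : |a * tilt κ δ σ s y| ≤ 1 := by
      rw [abs_mul]
      exact (mul_le_mul_of_nonneg_left (abs_tilt_le κ hδ0 σ s y) (abs_nonneg _)).trans haδ
    linarith [neg_le_of_abs_le this]
  have hi := integrable_tilt κ hδ0 σ s ((mixFst κ (unifMeasure d) s).restrict E)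
  have hi' : Integrable (fun y => 1 + a * tilt κ δ σ s y)
      ((mixFst κ (unifMeasure d) s).restrict E) := (integrable_const _).add (hi.const_mul a)
  rw [withDensity_apply _ hE, ← ofReal_integral_eq_lintegral_ofReal hi' (ae_of_all _ hnn),
    integral_add (integrable_const _) (hi.const_mul a), integral_const_mul,
    setIntegral_tilt h hδ0 hδ σ s hE, ← ofReal_measureReal, mixFst_real κ _ s hE]
  congr 1
  simp only [skewedPMF_toReal, integral_const, smul_eq_mul, mul_one,
    measureReal_restrict_apply_univ, mixFst_unif_real κ s hE]
  rw [mul_div_assoc', Finset.mul_sum, ← add_div, ← Finset.sum_add_distrib, Finset.sum_div]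
  refine Finset.sum_congr rfl fun j _ => ?_
  ring

/-- At fixed `s` and `y` the tilt is a Rademacher sum with at most d/2 coefficients of size at most
2δ/d, whose squares add up to at most 2δ²/d. -/
theorem sum_exp_tilt_le (κ : Kernel (Fin d × S) Y) {δ : ℝ} (hδ0 : 0 ≤ δ) (s : S) (y : Y) (l : ℝ) :
    ∑ σ : Fin (d / 2) → Bool, Real.exp (l * tilt κ δ σ s y) ≤
      Fintype.card (Fin (d / 2) → Bool) * Real.exp (l ^ 2 * (2 * δ ^ 2 / d) / 2) := by
  have hd : (0 : ℝ) < d := Nat.cast_pos.2 (NeZero.pos d)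
  set b : Fin (d / 2) → ℝ := fun i => l / d *
    (deviation κ δ ⟨2 * i, by omega⟩ s y - deviation κ δ ⟨2 * i + 1, by omega⟩ s y)
  have hb : ∀ σ, l * tilt κ δ σ s y = ∑ i, boolSign (σ i) * b i := fun σ => by
    unfold tilt
    rw [sum_pairSign_mul, mul_div_assoc', Finset.mul_sum, Finset.sum_div]
    exact Finset.sum_congr rfl fun i _ => by simp only [b]; ring
  simp_rw [hb]
  refine (sum_exp_sum_boolSign_le b).trans ?_
  gcongr
  calc ∑ i, b i ^ 2 ≤ ∑ i : Fin (d / 2), (l / d) ^ 2 * (2 * δ) ^ 2 := by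
        refine Finset.sum_le_sum fun i _ => ?_
        simp only [b]
        rw [mul_pow]
        gcongr ?_ * ?_
        refine sq_le_sq' ?_ ?_
        · linarith [neg_le_of_abs_le (abs_deviation_le κ hδ0 ⟨2 * i, by omega⟩ s y),
            le_of_abs_le (abs_deviation_le κ hδ0 ⟨2 * i + 1, by omega⟩ s y)]
        · linarith [neg_le_of_abs_le (abs_deviation_le κ hδ0 ⟨2 * i + 1, by omega⟩ s y),
            le_of_abs_le (abs_deviation_le κ hδ0 ⟨2 * i, by omega⟩ s y)]
    _ = (d / 2 : ℕ) * ((l / d) ^ 2 * (2 * δ) ^ 2) := by simp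
    _ ≤ (d / 2) * ((l / d) ^ 2 * (2 * δ) ^ 2) := by
        gcongr
        exact Nat.cast_div_le
    _ = l ^ 2 * (2 * δ ^ 2 / d) := by field_simp

end deviation

/-! ### Amplified message laws for corrupted users. -/

/-- Clamping to `[-1/2, 1/2]`. -/
noncomputable def clampHalf (x : ℝ) : ℝ := max (-(1 / 2)) (min (1 / 2) x)

theorem measurable_clampHalf : Measurable clampHalf :=
  measurable_const.max (measurable_const.min measurable_id)

theorem abs_clampHalf_le (x : ℝ) : |clampHalf x| ≤ 1 / 2 :=
  abs_le.2 ⟨le_max_left _ _, max_le (by norm_num) (min_le_left _ _)⟩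

theorem abs_clampHalf_sub_le (x : ℝ) : |clampHalf x - x| ≤ if 1 / 2 < |x| then |x| else 0 := by
  unfold clampHalf
  split_ifs with h
  · rcases lt_abs.1 h with h' | h'
    · rw [min_eq_left h'.le, max_eq_right (by norm_num), abs_of_nonpos (by linarith),
        abs_of_pos (by linarith)]
      linarith
    · rw [min_eq_right (by linarith), max_eq_left (by linarith), abs_of_nonneg (by linarith),
        abs_of_neg (by linarith)]
      linarith
  · rw [not_lt, abs_le] at h
    rw [min_eq_right h.2, max_eq_right h.1, sub_self, abs_zero]

section centered

variable {Y : Type*} [MeasurableSpace Y] (μ : Measure Y) {g : Y → ℝ}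

/-- The clamp of `g`, centered. -/
noncomputable def centeredClamp (g : Y → ℝ) (y : Y) : ℝ :=
  clampHalf (g y) - ∫ y', clampHalf (g y') ∂μ

theorem measurable_centeredClamp (hg : Measurable g) : Measurable (centeredClamp μ g) :=
  (measurable_clampHalf.comp hg).sub_const _

variable [IsProbabilityMeasure μ]

theorem integrable_clampHalf (hg : Measurable g) : Integrable (fun y => clampHalf (g y)) μ :=
  Integrable.of_bound (measurable_clampHalf.comp hg).aestronglyMeasurable (1 / 2)
    (ae_of_all _ fun _ => abs_clampHalf_le _)

/-- Centring can double the bound, which is why the clamp is at 1/2: `1 + centeredClamp` stays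
nonnegative. -/
theorem abs_centeredClamp_le (y : Y) : |centeredClamp μ g y| ≤ 1 := by
  have h1 := abs_clampHalf_le (g y)
  have h2 : |∫ y', clampHalf (g y') ∂μ| ≤ 1 / 2 := by
    have := norm_integral_le_of_norm_le_const (μ := μ) (f := fun y => clampHalf (g y))
      (ae_of_all _ fun y => abs_clampHalf_le (g y))
    simpa using this
  calc _ ≤ |clampHalf (g y)| + |∫ y', clampHalf (g y') ∂μ| := abs_sub _ _
    _ ≤ 1 := by linarith

theorem integrable_centeredClamp (hg : Measurable g) : Integrable (centeredClamp μ g) μ :=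
  (integrable_clampHalf μ hg).sub (integrable_const _)

theorem integral_centeredClamp (hg : Measurable g) : ∫ y, centeredClamp μ g y ∂μ = 0 := by
  unfold centeredClamp
  rw [integral_sub (integrable_clampHalf μ hg) (integrable_const _)]
  simp

theorem mixture_withDensity (hg : Measurable g) {w : ℝ} (hw0 : 0 ≤ w) (hw1 : w ≤ 1) :
    ENNReal.ofReal w • μ.withDensity (fun y => ENNReal.ofReal (1 + centeredClamp μ g y)) +
        ENNReal.ofReal (1 - w) • μ =
      μ.withDensity fun y => ENNReal.ofReal (1 + w * centeredClamp μ g y) := by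
  have hm : Measurable fun y => ENNReal.ofReal (1 + centeredClamp μ g y) :=
    ((measurable_centeredClamp μ hg).const_add 1).ennreal_ofReal
  have h : (fun y => ENNReal.ofReal (1 + w * centeredClamp μ g y)) =
      (ENNReal.ofReal w • fun y => ENNReal.ofReal (1 + centeredClamp μ g y)) +
        fun _ => ENNReal.ofReal (1 - w) := by
    funext y
    have := neg_le_of_abs_le (abs_centeredClamp_le μ (g := g) y)
    rw [Pi.add_apply, Pi.smul_apply, smul_eq_mul, ← ENNReal.ofReal_mul hw0,
      ← ENNReal.ofReal_add (mul_nonneg hw0 (by linarith)) (by linarith)]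
    congr 1
    ring
  rw [h, withDensity_add_right _ measurable_const, withDensity_smul _ hm, withDensity_const]

/-- The clamping error vanishes off the bad event and, after scaling by `w`, is at most 1 on it. As
`g` has mean zero, the centring term is the mean of that error and costs the same again; hence the
factor 2. -/
theorem lintegral_sub_density_le (hg : Measurable g) (hgi : Integrable g μ)
    (hg0 : ∫ y, g y ∂μ = 0) {w : ℝ} (hw0 : 0 ≤ w) (hwg : ∀ y, |w * g y| ≤ 1) :
    ∫⁻ y, (ENNReal.ofReal (1 + w * centeredClamp μ g y) - ENNReal.ofReal (1 + w * g y)) ∂μ ≤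
      2 * μ {y | 1 / 2 < |g y|} := by
  have hE : MeasurableSet {y | 1 / 2 < |g y|} := measurableSet_lt measurable_const hg.abs
  set v : Y → ℝ := fun y => clampHalf (g y) - g y with hv
  have hvi : Integrable v μ := (integrable_clampHalf μ hg).sub hgi
  have hvm : ∫ y, clampHalf (g y) ∂μ = ∫ y, v y ∂μ := by
    rw [hv, integral_sub (integrable_clampHalf μ hg) hgi, hg0, sub_zero]
  have hvb : ∀ y, ENNReal.ofReal (w * |v y|) ≤ Set.indicator {y | 1 / 2 < |g y|} 1 y := fun y => by
    have := abs_clampHalf_sub_le (g y)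
    by_cases hy : 1 / 2 < |g y|
    · rw [Set.indicator_of_mem (by exact hy), Pi.one_apply, ENNReal.ofReal_le_one]
      rw [if_pos hy] at this
      calc w * |v y| ≤ w * |g y| := by gcongr
        _ = |w * g y| := by rw [abs_mul, abs_of_nonneg hw0]
        _ ≤ 1 := hwg y
    · rw [if_neg hy] at this
      have h0 : |v y| = 0 := le_antisymm this (abs_nonneg _)
      rw [h0, mul_zero, ENNReal.ofReal_zero]
      exact bot_le
  have hvl : ∫⁻ y, ENNReal.ofReal (w * |v y|) ∂μ ≤ μ {y | 1 / 2 < |g y|} := by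
    rw [← lintegral_indicator_one hE]
    exact lintegral_mono hvb
  have hmean : ENNReal.ofReal (w * |∫ y, v y ∂μ|) ≤ μ {y | 1 / 2 < |g y|} := by
    refine le_trans ?_ hvl
    rw [← ofReal_integral_eq_lintegral_ofReal (hvi.abs.const_mul w)
      (ae_of_all _ fun y => mul_nonneg hw0 (abs_nonneg _)), integral_const_mul]
    gcongr
    exact abs_integral_le_integral_abs
  calc _ ≤ ∫⁻ y, (ENNReal.ofReal (w * |v y|) + ENNReal.ofReal (w * |∫ y, v y ∂μ|)) ∂μ := by
        refine lintegral_mono fun y => ?_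
        have h1 := neg_le_of_abs_le (hwg y)
        rw [← ENNReal.ofReal_sub _ (by linarith), ← ENNReal.ofReal_add (by positivity)
          (by positivity)]
        refine ENNReal.ofReal_le_ofReal ?_
        have h2 : 1 + w * centeredClamp μ g y - (1 + w * g y) = w * (v y - ∫ y, v y ∂μ) := by
          rw [centeredClamp, hvm, hv]; ring
        rw [h2, ← mul_add]
        gcongr
        linarith [le_abs_self (v y), neg_abs_le (∫ y, v y ∂μ)]
    _ = ∫⁻ y, ENNReal.ofReal (w * |v y|) ∂μ + ENNReal.ofReal (w * |∫ y, v y ∂μ|) := by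
        rw [lintegral_add_right _ measurable_const]; simp
    _ ≤ _ := by rw [two_mul]; exact add_le_add hvl hmean

end centered

section attackKernel

variable {S Y : Type*} [MeasurableSpace S] [MeasurableSpace Y]
  [MeasurableSpace.CountablyGenerated Y] {d : ℕ} [NeZero d]

/-- The message law of a corrupted user: the uniform mixture, amplified along the tilt. -/
noncomputable def attackKernel (κ : Kernel (Fin d × S) Y) [IsMarkovKernel κ] (δ l : ℝ)
    (σ : Fin (d / 2) → Bool) : Kernel S Y :=
  (mixFst κ (unifMeasure d)).withDensity fun s y =>
    ENNReal.ofReal (1 + centeredClamp (mixFst κ (unifMeasure d) s) (fun y => l * tilt κ δ σ s y) y)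

theorem attackKernel_apply (κ : Kernel (Fin d × S) Y) [IsMarkovKernel κ] (δ l : ℝ)
    (σ : Fin (d / 2) → Bool) (s : S) :
    attackKernel κ δ l σ s = (mixFst κ (unifMeasure d) s).withDensity fun y =>
      ENNReal.ofReal
        (1 + centeredClamp (mixFst κ (unifMeasure d) s) (fun y => l * tilt κ δ σ s y) y) := by
  unfold attackKernel
  rw [Kernel.withDensity_apply]
  have h : Measurable fun p : S × Y => clampHalf (l * tilt κ δ σ p.1 p.2) :=
    measurable_clampHalf.comp ((measurable_tilt κ δ σ).const_mul l)
  refine (Measurable.const_add (h.sub ?_) 1).ennreal_ofReal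
  exact (StronglyMeasurable.integral_kernel_prod_right (κ := mixFst κ (unifMeasure d))
    (f := fun s y => clampHalf (l * tilt κ δ σ s y)) h.stronglyMeasurable).measurable.comp
    measurable_fst

theorem measurable_mul_tilt (κ : Kernel (Fin d × S) Y) (δ l : ℝ)
    (σ : Fin (d / 2) → Bool) (s : S) : Measurable fun y => l * tilt κ δ σ s y :=
  ((measurable_tilt κ δ σ).comp measurable_prodMk_left).const_mul l

instance (κ : Kernel (Fin d × S) Y) [IsMarkovKernel κ] (δ l : ℝ)
    (σ : Fin (d / 2) → Bool) : IsMarkovKernel (attackKernel κ δ l σ) := ⟨fun s => by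
  rw [attackKernel_apply]
  have hm := measurable_mul_tilt κ δ l σ s
  exact isProbabilityMeasure_withDensity_one_add _ (integrable_centeredClamp _ hm)
    (fun y => by linarith [neg_le_of_abs_le (abs_centeredClamp_le (mixFst κ (unifMeasure d) s)
      (g := fun y => l * tilt κ δ σ s y) y)]) (integral_centeredClamp _ hm)⟩

end attackKernel

/-! ### From average error over the signs to an attack. -/

section protocols

variable {S Y Z : Type*} [MeasurableSpace S] [MeasurableSpace Y] [MeasurableSpace Z]
  {m n d : ℕ}

/-- First-moment method, choosing `ω` before the public string is drawn. Superadditivity of the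
lower integral suffices, so `F` need not be measurable. -/
theorem exists_lintegral_le_of_sum_le {Ω : Type*} [Fintype Ω] [Nonempty Ω] (P : Measure S)
    [IsProbabilityMeasure P] (F : Ω → S → ℝ≥0∞) {δ : ℝ≥0∞}
    (hF : ∀ s, ∑ ω, F ω s ≤ Fintype.card Ω * δ) : ∃ ω, ∫⁻ s, F ω s ∂P ≤ δ := by
  classical
  have hsup : ∀ T : Finset Ω, ∑ ω ∈ T, ∫⁻ s, F ω s ∂P ≤ ∫⁻ s, ∑ ω ∈ T, F ω s ∂P := fun T => by
    induction T using Finset.induction_on with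
    | empty => simp
    | insert ω T h ih =>
      simp_rw [Finset.sum_insert h]
      exact (add_le_add_right ih _).trans (le_lintegral_add _ _)
  have : ∑ ω, ∫⁻ s, F ω s ∂P ≤ ∑ _ω : Ω, δ := by
    refine (hsup _).trans ((lintegral_mono hF).trans ?_)
    simp
  by_contra! hlt
  exact this.not_gt (ENNReal.sum_lt_sum_of_nonempty Finset.univ_nonempty fun ω _ => hlt ω)

theorem indistinguishable_of_lintegral_le (μ ν : Measure Z) [IsProbabilityMeasure μ]
    [IsProbabilityMeasure ν] (h : ∀ f : Z → ℝ≥0∞, Measurable f → (∀ z, f z ≤ 1) →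
      ∫⁻ z, f z ∂μ ≤ ∫⁻ z, f z ∂ν + ENNReal.ofReal (1 / 3)) : Indistinguishable μ ν := by
  have h1 : ∀ E, MeasurableSet E → μ.real E ≤ ν.real E + 1 / 3 := fun E hE => by
    have := h (E.indicator 1) (measurable_one.indicator hE)
      (fun z => Set.indicator_le_self' (fun _ _ => zero_le_one) z)
    rw [lintegral_indicator_one hE, lintegral_indicator_one hE] at this
    have h2 := ENNReal.toReal_mono (by finiteness) this
    rwa [ENNReal.toReal_add (by finiteness) (by finiteness),
      ENNReal.toReal_ofReal (by norm_num)] at h2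
  intro E hE
  have h2 := h1 E hE
  -- The one-sided bound on the complement is the other side on `E`.
  have h3 := h1 Eᶜ hE.compl
  rw [probReal_compl_eq_one_sub hE, probReal_compl_eq_one_sub hE] at h3
  exact abs_le.2 ⟨by linarith, by linarith⟩

theorem isProbabilityMeasure_outputDist (Pr : LocalProtocol (Fin d) S Y Z n) (P : Measure (Fin d))
    [IsProbabilityMeasure P] : IsProbabilityMeasure (Pr.outputDist P) := by
  unfold LocalProtocol.outputDist LocalProtocol.output; infer_instance

theorem isProbabilityMeasure_manipOutputDist (Pr : LocalProtocol (Fin d) S Y Z n)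
    (P : Measure (Fin d)) [IsProbabilityMeasure P] (M : Attacker S Y m n) :
    IsProbabilityMeasure (Pr.manipOutputDist P M) := by
  have : IsMarkovKernel (((Kernel.const (Fin n → Fin d) Pr.pub ⊗ₖ
      M.strat.comap Prod.snd measurable_snd) ⊗ₖ piKernel Pr.manipMessage).map
        (fun p : (S × (Finset (Fin n) × (Fin n → Y))) × (Fin n → Y) => (p.1.1, p.2))) :=
    Kernel.IsMarkovKernel.map _ (by fun_prop)
  unfold LocalProtocol.manipOutputDist LocalProtocol.manipOutput; infer_instance

/-- Error budget: 1/5 for the best `σ` and 1/10 for too many successful coins, in total 3/10 < 1/3.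
The success probability m/(10n) makes the expected number of corruptions m/10. -/
theorem manipulableBy_of_sum_le [NeZero d] (Pr : LocalProtocol (Fin d) S Y Z n) (hd : 2 ≤ d) (hm : m ≤ n)
    (hn : 0 < n) {a : ℝ} (ha0 : 0 ≤ a) (ha : |a| ≤ 1)
    (q : (Fin (d / 2) → Bool) → Fin n → Kernel S Y) [∀ σ i, IsMarkovKernel (q σ i)]
    (F : (Fin (d / 2) → Bool) → S → ℝ≥0∞)
    (hF : ∀ σ s, (Measure.pi fun i => ENNReal.ofReal (m / (10 * n)) • q σ i s +
        ENNReal.ofReal (1 - m / (10 * n)) • mixFst (Pr.rand i) (unifMeasure d) s).WithinTV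
      (Measure.pi fun i => mixFst (Pr.rand i) (skewedPMF σ a ha).toMeasure s) (F σ s))
    (hsum : ∀ s, ∑ σ, F σ s ≤ Fintype.card (Fin (d / 2) → Bool) * ENNReal.ofReal (1 / 5))
    {c₁ c₂ r : ℝ} (hc₁ : c₁ * r ≤ 2 / 3 * a) (hc₂ : a ≤ c₂ * r) : ManipulableBy Pr m c₁ c₂ r := by
  have hn0 : (0 : ℝ) < n := Nat.cast_pos.2 hn
  have hmn : (m : ℝ) ≤ n := Nat.cast_le.2 hm
  have hw : (m : ℝ) / (10 * n) ≤ 1 := by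
    rw [div_le_one (by positivity)]; linarith
  have hp : ENNReal.ofReal (m / (10 * n)) + ENNReal.ofReal (1 - m / (10 * n)) = 1 := by
    rw [← ENNReal.ofReal_add (by positivity) (by linarith)]; simp
  obtain ⟨σ, hσ⟩ := exists_lintegral_le_of_sum_le Pr.pub F hsum
  obtain ⟨M, hM⟩ := Pr.exists_attacker (unifMeasure d) hm (q σ) hp
  obtain ⟨hl, hu⟩ := l1Dist_uniform_skewedPMF_bounds hd σ ha0 ha
  refine ⟨M, skewedPMF σ a ha, hc₁.trans hl, hu.trans hc₂, ?_⟩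
  have := isProbabilityMeasure_outputDist Pr (skewedPMF σ a ha).toMeasure
  have := isProbabilityMeasure_manipOutputDist Pr (unifMeasure d) M
  refine indistinguishable_of_lintegral_le _ _ fun f hf hf1 => (hM f hf hf1).trans ?_
  rw [Pr.lintegral_outputDist _ hf]
  have hG : Measurable fun p : S × (Fin n → Y) => ∫⁻ z, f z ∂Pr.agg p := hf.lintegral_kernel
  have hG1 : ∀ p, ∫⁻ z, f z ∂Pr.agg p ≤ 1 := fun p => by
    calc ∫⁻ z, f z ∂Pr.agg p ≤ ∫⁻ _, 1 ∂Pr.agg p := lintegral_mono hf1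
      _ = 1 := by simp
  have hcoin : (∑ B : Finset (Fin n), if m < B.card then coinWeight (ENNReal.ofReal (m / (10 * n)))
      (ENNReal.ofReal (1 - m / (10 * n))) B else 0) ≤ ENNReal.ofReal (1 / 10) := by
    have h := sum_coinWeight_card (n := n) hp m
    have hc0 : (m : ℝ≥0∞) + 1 ≠ 0 := by simp
    refine (ENNReal.mul_le_mul_iff_left hc0 (by finiteness)).1 (h.trans ?_)
    rw [← ENNReal.ofReal_natCast, ← ENNReal.ofReal_mul hn0.le, ← ENNReal.ofReal_natCast,
      ← ENNReal.ofReal_one, ← ENNReal.ofReal_add (by positivity) zero_le_one,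
      ← ENNReal.ofReal_mul (by norm_num)]
    refine ENNReal.ofReal_le_ofReal ?_
    rw [show (n : ℝ) * (m / (10 * n)) = m / 10 by field_simp]
    linarith
  have hmeas : Measurable fun s => ∫⁻ y, ∫⁻ z, f z ∂Pr.agg (s, y)
      ∂Measure.pi (fun i => mixFst (Pr.rand i) (skewedPMF σ a ha).toMeasure s) :=
    Measurable.lintegral_kernel_prod_right
      (κ := piKernel fun i => mixFst (Pr.rand i) (skewedPMF σ a ha).toMeasure)
      (f := fun s y => ∫⁻ z, f z ∂Pr.agg (s, y)) hG
  calc _ ≤ ∫⁻ s, (∫⁻ y, ∫⁻ z, f z ∂Pr.agg (s, y)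
          ∂Measure.pi (fun i => mixFst (Pr.rand i) (skewedPMF σ a ha).toMeasure s) + F σ s)
          ∂Pr.pub + ENNReal.ofReal (1 / 10) :=
        add_le_add (lintegral_mono fun s => hF σ s _ (hG.comp measurable_prodMk_left)
          fun y => hG1 (s, y)) hcoin
    _ ≤ _ := by
        rw [lintegral_add_left hmeas, add_assoc]
        gcongr
        refine (add_le_add_left hσ _).trans ?_
        rw [← ENNReal.ofReal_add (by norm_num) (by norm_num)]
        exact ENNReal.ofReal_le_ofReal (by norm_num)

end protocols

/-! ### The two attacks. -/

section attacks

variable {S Y Z : Type*} [MeasurableSpace S] [MeasurableSpace Y]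
  [MeasurableSpace.CountablyGenerated Y] [MeasurableSpace Z] {m n d : ℕ} [NeZero d]

theorem manipulableBy_of_small_skew (Pr : LocalProtocol (Fin d) S Y Z n) {ε δ : ℝ}
    (hPr : Pr.IsLDP ε) (hδ0 : 0 < δ) (hδ : Real.exp ε - 1 ≤ δ) (hd : 2 ≤ d) (hm : m ≤ n)
    (hn : 0 < n) {a : ℝ} (ha0 : 0 ≤ a) (ha : |a| ≤ 1) (haδ : |a| * δ ≤ 1)
    (hsmall : n * (a ^ 2 * (8 * (2 * δ ^ 2 / d))) ≤ 1 / 50)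
    {c₁ c₂ r : ℝ} (hc₁ : c₁ * r ≤ 2 / 3 * a) (hc₂ : a ≤ c₂ * r) : ManipulableBy Pr m c₁ c₂ r := by
  have hn0 : (0 : ℝ) < n := Nat.cast_pos.2 hn
  have hd0 : (0 : ℝ) < d := Nat.cast_pos.2 (NeZero.pos d)
  have hmn : (m : ℝ) ≤ n := Nat.cast_le.2 hm
  have hw : (m : ℝ) / (10 * n) ≤ 1 := by
    rw [div_le_one (by positivity)]; linarith
  have hp : ENNReal.ofReal (m / (10 * n)) + ENNReal.ofReal (1 - m / (10 * n)) = 1 := by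
    rw [← ENNReal.ofReal_add (by positivity) (by linarith)]; simp
  have hK : ∀ i, KernelLDP (Pr.rand i) ε := fun i => hPr i
  have htm : ∀ σ i s, Measurable fun y => a * tilt (Pr.rand i) δ σ s y := fun σ i s =>
    measurable_mul_tilt _ _ _ _ _
  have htb : ∀ σ i s y, |a * tilt (Pr.rand i) δ σ s y| ≤ 1 := fun σ i s y => by
    rw [abs_mul]
    exact (mul_le_mul_of_nonneg_left (abs_tilt_le _ hδ0.le σ s y) (abs_nonneg _)).trans haδ
  -- Corrupted users behave honestly, so the mixture collapses to the uniform message law. The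
  -- choice τ = 1/5 gives error 1/10 + 5X, and X averages to at most 1/50.
  refine manipulableBy_of_sum_le Pr hd hm hn ha0 ha
    (fun _ i => mixFst (Pr.rand i) (unifMeasure d))
    (fun σ s => ENNReal.ofReal ((1 / 5 : ℝ) / 2 +
      (∑ i, ∫ y, (a * tilt (Pr.rand i) δ σ s y) ^ 2 ∂mixFst (Pr.rand i) (unifMeasure d) s) /
        (1 / 5))) (fun σ s => ?_) (fun s => ?_) hc₁ hc₂
  · simp_rw [← add_smul, hp, one_smul, fun i => mixFst_skewedPMF (hK i) hδ0.le hδ σ s ha haδ]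
    exact withinTV_pi_of_sq _ (fun i => htm σ i s) (fun i y => htb σ i s y)
      (fun i => by rw [integral_const_mul, integral_tilt (hK i) hδ0.le hδ, mul_zero])
      (by norm_num) (by norm_num)
  · have hsq : ∀ i σ, Integrable (fun y => (a * tilt (Pr.rand i) δ σ s y) ^ 2)
        (mixFst (Pr.rand i) (unifMeasure d) s) := fun i σ =>
      Integrable.of_bound ((htm σ i s).pow_const 2).aestronglyMeasurable 1
        (ae_of_all _ fun y => by
          rw [Real.norm_eq_abs, abs_pow]; exact pow_le_one₀ (abs_nonneg _) (htb σ i s y))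
    set N : ℝ := ((Fintype.card (Fin (d / 2) → Bool) : ℕ) : ℝ) with hN
    have hi : ∀ i, ∑ σ, ∫ y, (a * tilt (Pr.rand i) δ σ s y) ^ 2
        ∂mixFst (Pr.rand i) (unifMeasure d) s ≤ N * (a ^ 2 * (8 * (2 * δ ^ 2 / d))) := fun i => by
      rw [← integral_finsetSum _ fun σ _ => hsq i σ]
      calc _ ≤ ∫ _, N * (a ^ 2 * (8 * (2 * δ ^ 2 / d))) ∂mixFst (Pr.rand i) (unifMeasure d) s := by
            refine integral_mono (integrable_finsetSum _ fun σ _ => hsq i σ)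
              (integrable_const _) fun y => ?_
            have := sum_sq_le_of_mgf (fun σ => tilt (Pr.rand i) δ σ s y)
              (V := 2 * δ ^ 2 / d) (by positivity)
              (sum_exp_tilt_le (Pr.rand i) hδ0.le s y)
            simp only [mul_pow]
            rw [← Finset.mul_sum]
            calc _ ≤ a ^ 2 * (N * (8 * (2 * δ ^ 2 / d))) := by gcongr
              _ = _ := by ring
        _ = _ := by simp
    rw [← ENNReal.ofReal_sum_of_nonneg fun σ _ => by positivity, ← ENNReal.ofReal_natCast,
      ← ENNReal.ofReal_mul (Nat.cast_nonneg _)]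
    refine ENNReal.ofReal_le_ofReal ?_
    have h1 : ∑ i : Fin n, ∑ σ, ∫ y, (a * tilt (Pr.rand i) δ σ s y) ^ 2
        ∂mixFst (Pr.rand i) (unifMeasure d) s ≤ N * (1 / 50) := by
      calc _ ≤ ∑ _i : Fin n, N * (a ^ 2 * (8 * (2 * δ ^ 2 / d))) :=
            Finset.sum_le_sum fun i _ => hi i
        _ = N * (n * (a ^ 2 * (8 * (2 * δ ^ 2 / d)))) := by simp; ring
        _ ≤ _ := by gcongr
    have h2 : ∑ _σ : Fin (d / 2) → Bool, (1 / 5 : ℝ) / 2 = N * (1 / 10) := by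
      rw [Finset.sum_const, Finset.card_univ, nsmul_eq_mul, hN]; ring
    rw [Finset.sum_add_distrib, h2, ← Finset.sum_div, Finset.sum_comm]
    linarith

theorem manipulableBy_of_tail (Pr : LocalProtocol (Fin d) S Y Z n) {ε δ : ℝ}
    (hPr : Pr.IsLDP ε) (hδ0 : 0 < δ) (hδ : Real.exp ε - 1 ≤ δ) (hd : 2 ≤ d) (hm : m ≤ n)
    (hm0 : 0 < m) {a : ℝ} (ha0 : 0 ≤ a) (ha : |a| ≤ 1) (haδ : |a| * δ ≤ 1) {l : ℝ}
    (hl : m / (10 * n) * l = a)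
    (htail : ∀ s, ∑ σ, min 1 (∑ i, 2 * mixFst (Pr.rand i) (unifMeasure d) s
        {y | 1 / 2 < |l * tilt (Pr.rand i) δ σ s y|}) ≤
      Fintype.card (Fin (d / 2) → Bool) * ENNReal.ofReal (1 / 5))
    {c₁ c₂ r : ℝ} (hc₁ : c₁ * r ≤ 2 / 3 * a) (hc₂ : a ≤ c₂ * r) : ManipulableBy Pr m c₁ c₂ r := by
  have hn : 0 < n := hm0.trans_le hm
  have hn0 : (0 : ℝ) < n := Nat.cast_pos.2 hn
  have hmn : (m : ℝ) ≤ n := Nat.cast_le.2 hm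
  have hw0 : (0 : ℝ) ≤ (m : ℝ) / (10 * n) := by positivity
  have hw1 : (m : ℝ) / (10 * n) ≤ 1 := by
    rw [div_le_one (by positivity)]; linarith
  have hK : ∀ i, KernelLDP (Pr.rand i) ε := fun i => hPr i
  refine manipulableBy_of_sum_le Pr hd hm hn ha0 ha
    (fun σ i => attackKernel (Pr.rand i) δ l σ) _ (fun σ s => ?_) htail hc₁ hc₂
  intro f hf hf1
  rw [min_def]
  have hpos : ∀ (u : Y → ℝ), (∀ y, |u y| ≤ 1) → ∀ y, 0 ≤ 1 + u y := fun u hu y => by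
    linarith [neg_le_of_abs_le (hu y)]
  have hltm : ∀ i, Measurable fun y => l * tilt (Pr.rand i) δ σ s y := fun i =>
    measurable_mul_tilt _ _ _ _ _
  set μ : Fin n → Measure Y := fun i => mixFst (Pr.rand i) (unifMeasure d) s with hμ
  have hμp : ∀ i, IsProbabilityMeasure (μ i) := fun i => by simp only [hμ]; infer_instance
  set v : Fin n → Y → ℝ := fun i y =>
    m / (10 * n) * centeredClamp (μ i) (fun y => l * tilt (Pr.rand i) δ σ s y) y with hv
  have hvb : ∀ i y, |v i y| ≤ 1 := fun i y => by
    simp only [hv]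
    rw [abs_mul, abs_of_nonneg hw0]
    exact mul_le_one₀ hw1 (abs_nonneg _) (abs_centeredClamp_le _ _)
  have hvm : ∀ i, Measurable (v i) := fun i => (measurable_centeredClamp _ (hltm i)).const_mul _
  have hmix : ∀ i, ENNReal.ofReal (m / (10 * n)) • attackKernel (Pr.rand i) δ l σ s +
      ENNReal.ofReal (1 - m / (10 * n)) • mixFst (Pr.rand i) (unifMeasure d) s =
      (μ i).withDensity fun y => ENNReal.ofReal (1 + v i y) := fun i => by
    rw [attackKernel_apply]
    exact mixture_withDensity (μ i) (hltm i) hw0 hw1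
  have ht : ∀ i, mixFst (Pr.rand i) (skewedPMF σ a ha).toMeasure s =
      (μ i).withDensity fun y => ENNReal.ofReal
        (1 + m / (10 * n) * (l * tilt (Pr.rand i) δ σ s y)) := fun i => by
    simp_rw [← mul_assoc, hl]
    exact mixFst_skewedPMF (hK i) hδ0.le hδ σ s ha haδ
  have hp1 : ∀ i, IsProbabilityMeasure ((μ i).withDensity fun y => ENNReal.ofReal (1 + v i y)) :=
    fun i => isProbabilityMeasure_withDensity_one_add _
      ((integrable_centeredClamp (μ i) (hltm i)).const_mul _) (hpos _ (hvb i)) (by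
        simp only [hv]
        rw [integral_const_mul, integral_centeredClamp _ (hltm i), mul_zero])
  have hp2 : ∀ i, IsProbabilityMeasure ((μ i).withDensity fun y => ENNReal.ofReal
      (1 + m / (10 * n) * (l * tilt (Pr.rand i) δ σ s y))) := fun i => by
    rw [← ht i]; infer_instance
  simp_rw [hmix, ht]
  -- A cap of 1 on the error is free; the finite-message bound needs it, since there one bad message
  -- is charged the whole error.
  split_ifs
  · exact withinTV_one _ _ f hf hf1
  · refine (withinTV_pi_withDensity μ (h := fun i y => ENNReal.ofReal
        (1 + m / (10 * n) * (l * tilt (Pr.rand i) δ σ s y))) (fun i => ((hvm i).const_add 1).ennreal_ofReal)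
      (fun i => (((hltm i).const_mul _).const_add 1).ennreal_ofReal) f hf hf1).trans ?_
    gcongr with i
    refine lintegral_sub_density_le (μ i) (hltm i)
      ((integrable_tilt (Pr.rand i) hδ0.le σ s _).const_mul l) ?_ hw0 fun y => ?_
    · rw [integral_const_mul, integral_tilt (hK i) hδ0.le hδ, mul_zero]
    · rw [← mul_assoc, hl, abs_mul]
      exact (mul_le_mul_of_nonneg_left (abs_tilt_le _ hδ0.le σ s y) (abs_nonneg _)).trans haδ

end attacks

/-! ### Union bounds for the bad event. -/

section union_bounds

variable {S Y Z : Type*} [MeasurableSpace S] [MeasurableSpace Y]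
  [MeasurableSpace.CountablyGenerated Y] [MeasurableSpace Z] {m n d : ℕ} [NeZero d]

/-- The reference law does not depend on `σ`, so the average over `σ` moves inside it and the tail
bound at each fixed message applies. -/
theorem sum_min_le_of_users (Pr : LocalProtocol (Fin d) S Y Z n) {δ l η : ℝ}
    (h : ∀ i s y, ∑ σ, (if 1 / 2 < |l * tilt (Pr.rand i) δ σ s y| then (1 : ℝ) else 0) ≤
      Fintype.card (Fin (d / 2) → Bool) * η)
    (hη' : n * (2 * η) ≤ 1 / 5) (s : S) :
    ∑ σ, min 1 (∑ i, 2 * mixFst (Pr.rand i) (unifMeasure d) s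
        {y | 1 / 2 < |l * tilt (Pr.rand i) δ σ s y|}) ≤
      Fintype.card (Fin (d / 2) → Bool) * ENNReal.ofReal (1 / 5) := by
  set N : ℝ := ((Fintype.card (Fin (d / 2) → Bool) : ℕ) : ℝ) with hN
  have hE : ∀ i σ, MeasurableSet {y | 1 / 2 < |l * tilt (Pr.rand i) δ σ s y|} := fun i σ =>
    measurableSet_lt measurable_const (measurable_mul_tilt _ _ _ _ _).abs
  have hi : ∀ i, ∑ σ, mixFst (Pr.rand i) (unifMeasure d) s
      {y | 1 / 2 < |l * tilt (Pr.rand i) δ σ s y|} ≤ ENNReal.ofReal (N * η) := fun i => by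
    simp_rw [← fun σ => lintegral_indicator_one (μ := mixFst (Pr.rand i) (unifMeasure d) s) (hE i σ)]
    rw [← lintegral_finsetSum _ fun σ _ => measurable_one.indicator (hE i σ)]
    calc _ ≤ ∫⁻ _, ENNReal.ofReal (N * η) ∂mixFst (Pr.rand i) (unifMeasure d) s := by
          refine lintegral_mono fun y => ?_
          refine le_trans (le_of_eq ?_) (ENNReal.ofReal_le_ofReal (h i s y))
          rw [ENNReal.ofReal_sum_of_nonneg fun σ _ => by split_ifs <;> norm_num]
          refine Finset.sum_congr rfl fun σ _ => ?_
          rw [Set.indicator_apply]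
          simp only [Set.mem_ofPred_eq, Pi.one_apply]
          split_ifs <;> simp
      _ = _ := by simp
  calc _ ≤ ∑ σ, ∑ i, 2 * mixFst (Pr.rand i) (unifMeasure d) s
        {y | 1 / 2 < |l * tilt (Pr.rand i) δ σ s y|} := Finset.sum_le_sum fun σ _ => min_le_right _ _
    _ = ∑ i, 2 * ∑ σ, mixFst (Pr.rand i) (unifMeasure d) s
        {y | 1 / 2 < |l * tilt (Pr.rand i) δ σ s y|} := by
        rw [Finset.sum_comm]; simp_rw [Finset.mul_sum]
    _ ≤ ∑ _i : Fin n, 2 * ENNReal.ofReal (N * η) := by gcongr with i; exact hi i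
    _ = ENNReal.ofReal (n * (2 * (N * η))) := by
        rw [Finset.sum_const, Finset.card_univ, Fintype.card_fin, nsmul_eq_mul,
          ENNReal.ofReal_mul n.cast_nonneg, ENNReal.ofReal_natCast n,
          ENNReal.ofReal_mul zero_le_two, ENNReal.ofReal_ofNat]
    _ ≤ ENNReal.ofReal (N * (1 / 5)) := by
        refine ENNReal.ofReal_le_ofReal ?_
        calc n * (2 * (N * η)) = N * (n * (2 * η)) := by ring
          _ ≤ _ := by gcongr
    _ = _ := by rw [ENNReal.ofReal_mul (by positivity), ENNReal.ofReal_natCast]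

/-- If no randomizer and message are bad for `σ`, the error is exactly 0; otherwise it is at most 1.
Only distinct randomizers count, so the number of users disappears. -/
theorem sum_min_le_of_finite [Finite Y] (Pr : LocalProtocol (Fin d) S Y Z n) {δ l η : ℝ}
    (h : ∀ i s y, ∑ σ, (if 1 / 2 < |l * tilt (Pr.rand i) δ σ s y| then (1 : ℝ) else 0) ≤
      Fintype.card (Fin (d / 2) → Bool) * η)
    (hη' : Nat.card Y * Pr.numRandomizers * η ≤ 1 / 5) (s : S) :
    ∑ σ, min 1 (∑ i, 2 * mixFst (Pr.rand i) (unifMeasure d) s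
        {y | 1 / 2 < |l * tilt (Pr.rand i) δ σ s y|}) ≤
      Fintype.card (Fin (d / 2) → Bool) * ENNReal.ofReal (1 / 5) := by
  have := Fintype.ofFinite Y
  set N : ℝ := ((Fintype.card (Fin (d / 2) → Bool) : ℕ) : ℝ) with hN
  set T := (Set.toFinite (Set.range Pr.rand)).toFinset with hT
  have hTcard : T.card = Pr.numRandomizers :=
    (Set.ncard_eq_toFinset_card _ (Set.toFinite (Set.range Pr.rand))).symm
  have hmem : ∀ κ ∈ T, ∃ i, Pr.rand i = κ := fun κ hκ => by simpa [hT] using hκ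
  have hbad : ∀ σ, min 1 (∑ i, 2 * mixFst (Pr.rand i) (unifMeasure d) s
        {y | 1 / 2 < |l * tilt (Pr.rand i) δ σ s y|}) ≤
      ENNReal.ofReal (∑ κ ∈ T, ∑ y : Y, if 1 / 2 < |l * tilt κ δ σ s y| then (1 : ℝ) else 0) := by
    intro σ
    have hnn : ∀ (κ : Kernel (Fin d × S) Y) (y : Y), 0 ≤ if 1 / 2 < |l * tilt κ δ σ s y| then (1 : ℝ) else 0 := fun κ y => by
      split_ifs <;> norm_num
    by_cases hb : ∃ i y, 1 / 2 < |l * tilt (Pr.rand i) δ σ s y|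
    · obtain ⟨i, y, hy⟩ := hb
      refine (min_le_left _ _).trans ?_
      rw [ENNReal.one_le_ofReal]
      calc (1 : ℝ) = if 1 / 2 < |l * tilt (Pr.rand i) δ σ s y| then (1 : ℝ) else 0 := by rw [if_pos hy]
        _ ≤ ∑ y : Y, if 1 / 2 < |l * tilt (Pr.rand i) δ σ s y| then (1 : ℝ) else 0 :=
          Finset.single_le_sum (f := fun y => if 1 / 2 < |l * tilt (Pr.rand i) δ σ s y| then
            (1 : ℝ) else 0) (fun y _ => hnn _ y) (Finset.mem_univ y)
        _ ≤ _ := Finset.single_le_sum (f := fun κ => ∑ y : Y,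
            if 1 / 2 < |l * tilt κ δ σ s y| then (1 : ℝ) else 0)
            (fun κ _ => Finset.sum_nonneg fun y _ => hnn κ y) (by simp [hT])
    · push Not at hb
      refine (min_le_right _ _).trans ?_
      rw [Finset.sum_eq_zero]
      · exact bot_le
      · intro i _
        have : {y | 1 / 2 < |l * tilt (Pr.rand i) δ σ s y|} = ∅ :=
          Set.eq_empty_of_forall_notMem fun y hy => (hb i y).not_gt hy
        rw [this, measure_empty, mul_zero]
  calc _ ≤ ∑ σ, ENNReal.ofReal (∑ κ ∈ T, ∑ y : Y,
          if 1 / 2 < |l * tilt κ δ σ s y| then (1 : ℝ) else 0) := Finset.sum_le_sum fun σ _ => hbad σ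
    _ = ENNReal.ofReal (∑ κ ∈ T, ∑ y : Y, ∑ σ,
          if 1 / 2 < |l * tilt κ δ σ s y| then (1 : ℝ) else 0) := by
        rw [← ENNReal.ofReal_sum_of_nonneg fun σ _ => Finset.sum_nonneg fun κ _ =>
          Finset.sum_nonneg fun y _ => by split_ifs <;> norm_num, Finset.sum_comm]
        congr 1
        exact Finset.sum_congr rfl fun κ _ => Finset.sum_comm
    _ ≤ ENNReal.ofReal (N * (1 / 5)) := by
        refine ENNReal.ofReal_le_ofReal ?_
        calc _ ≤ ∑ κ ∈ T, ∑ _y : Y, N * η := by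
              refine Finset.sum_le_sum fun κ hκ => Finset.sum_le_sum fun y _ => ?_
              obtain ⟨i, rfl⟩ := hmem κ hκ
              exact h i s y
          _ = N * (Nat.card Y * Pr.numRandomizers * η) := by
              rw [Finset.sum_const, Finset.sum_const, Finset.card_univ, hTcard,
                Nat.card_eq_fintype_card, nsmul_eq_mul, nsmul_eq_mul]
              ring
          _ ≤ _ := by gcongr
    _ = _ := by rw [ENNReal.ofReal_mul (by positivity), ENNReal.ofReal_natCast]

end union_bounds

/-! ### Choice of parameters. -/

section parameters

/-- The constant of proportionality between the skew of the data and the rate of the attack. -/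
noncomputable def attackConst (ε₀ : ℝ) : ℝ := 1 / (200 * Real.exp ε₀ * (1 + ε₀))

theorem attackConst_pos {ε₀ : ℝ} (h : 0 < ε₀) : 0 < attackConst ε₀ := by
  unfold attackConst; positivity

theorem attackConst_mul_exp_le {ε₀ : ℝ} (h : 0 < ε₀) :
    attackConst ε₀ * Real.exp ε₀ ≤ 1 / 200 := by
  unfold attackConst
  rw [div_mul_eq_mul_div, div_le_div_iff₀ (by positivity) (by norm_num)]
  nlinarith [mul_pos (Real.exp_pos ε₀) h]

theorem attackConst_mul_exp_mul_le {ε₀ : ℝ} (h : 0 < ε₀) :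
    attackConst ε₀ * (Real.exp ε₀ * ε₀) ≤ 1 := by
  unfold attackConst
  rw [div_mul_eq_mul_div, div_le_one (by positivity)]
  nlinarith [mul_pos (Real.exp_pos ε₀) h, Real.exp_pos ε₀]

theorem attackConst_le_one {ε₀ : ℝ} (h : 0 < ε₀) : attackConst ε₀ ≤ 1 := by
  have h1 := attackConst_mul_exp_le h
  have h2 : 1 ≤ Real.exp ε₀ := Real.one_le_exp h.le
  nlinarith [attackConst_pos h]

theorem exp_sub_one_le_mul {ε ε₀ : ℝ} (h0 : 0 < ε) (h : ε ≤ ε₀) :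
    Real.exp ε - 1 ≤ Real.exp ε₀ * ε := by
  have h1 := Real.add_one_le_exp (-ε)
  have h2 : Real.exp ε * Real.exp (-ε) = 1 := by rw [← Real.exp_add]; simp
  have h3 : Real.exp ε ≤ Real.exp ε₀ := Real.exp_le_exp.2 h
  nlinarith [Real.exp_pos ε]

variable {S Y Z : Type*} [MeasurableSpace S] [MeasurableSpace Y]
  [MeasurableSpace.CountablyGenerated Y] [MeasurableSpace Z] {m n d : ℕ} [NeZero d]

/-- Replacing 1/√n + m/n by the maximum of the two terms changes the rate by at most a factor 2,
which with the 2/3 from odd `d` gives the lower constant c/3. The larger term decides which attack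
is used. -/
theorem manipulableBy_of_union_bound (Pr : LocalProtocol (Fin d) S Y Z n) {ε ε₀ L : ℝ}
    (hε0 : 0 < ε) (hε : ε ≤ ε₀) (hPr : Pr.IsLDP ε) (hd : 2 ≤ d) (hm : m ≤ n) (hn : 0 < n)
    (hL : 1 / 2 ≤ L)
    (hunion : ∀ δ l : ℝ,
      (∀ i s y, ∑ σ, (if 1 / 2 < |l * tilt (Pr.rand i) δ σ s y| then (1 : ℝ) else 0) ≤
        Fintype.card (Fin (d / 2) → Bool) * (2 * Real.exp (-(25 * L)))) →
      ∀ s, ∑ σ, min 1 (∑ i, 2 * mixFst (Pr.rand i) (unifMeasure d) s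
          {y | 1 / 2 < |l * tilt (Pr.rand i) δ σ s y|}) ≤
        Fintype.card (Fin (d / 2) → Bool) * ENNReal.ofReal (1 / 5)) :
    ManipulableBy Pr m (attackConst ε₀ / 3) (attackConst ε₀) (min 1 (skew ε L d m n)) := by
  have hε₀ : 0 < ε₀ := hε0.trans_le hε
  have hn0 : (0 : ℝ) < n := Nat.cast_pos.2 hn
  have hd0 : (0 : ℝ) < d := Nat.cast_pos.2 (NeZero.pos d)
  have hL0 : 0 < L := by linarith
  set c := attackConst ε₀
  have hc0 : 0 < c := attackConst_pos hε₀
  set K := Real.exp ε₀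
  have hK0 : 0 < K := Real.exp_pos _
  have hcK : c * K ≤ 1 / 200 := attackConst_mul_exp_le hε₀
  set A : ℝ := 1 / ε * √(d / L) with hA
  have hA0 : 0 < A := by positivity
  have hA2 : A ^ 2 = d / (L * ε ^ 2) := by
    rw [hA, mul_pow, Real.sq_sqrt (by positivity)]; field_simp
  set x : ℝ := A * max (1 / √n) (m / n) with hx
  have hx0 : 0 < x := mul_pos hA0 (lt_max_of_lt_left (by positivity))
  have hxs : x ≤ skew ε L d m n := by
    unfold skew
    refine mul_le_mul_of_nonneg_left (max_le ?_ ?_) hA0.le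
    · linarith [show (0 : ℝ) ≤ m / n by positivity]
    · linarith [show (0 : ℝ) ≤ 1 / √n by positivity]
  have hsx : skew ε L d m n ≤ 2 * x := by
    unfold skew
    rw [hx, mul_left_comm]
    refine mul_le_mul_of_nonneg_left ?_ hA0.le
    linarith [le_max_left (1 / √n) ((m : ℝ) / n), le_max_right (1 / √n) ((m : ℝ) / n)]
  set a := c * min 1 x with ha_def
  have ha0 : 0 < a := mul_pos hc0 (lt_min one_pos hx0)
  have hac : a ≤ c := mul_le_of_le_one_right hc0.le (min_le_left _ _)
  have hax : a ≤ c * x := by rw [ha_def]; gcongr; exact min_le_right _ _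
  have ha1 : |a| ≤ 1 := by
    rw [abs_of_pos ha0]; exact hac.trans (attackConst_le_one hε₀)
  have hδ0 : 0 < K * ε := by positivity
  have haδ : |a| * (K * ε) ≤ 1 := by
    rw [abs_of_pos ha0]
    calc a * (K * ε) ≤ c * (K * ε₀) := by gcongr
      _ ≤ 1 := attackConst_mul_exp_mul_le hε₀
  have hc₁ : c / 3 * min 1 (skew ε L d m n) ≤ 2 / 3 * a := by
    have : min 1 (skew ε L d m n) ≤ 2 * min 1 x := by
      rw [mul_min_of_nonneg _ _ zero_le_two]
      exact min_le_min (by norm_num) hsx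
    calc c / 3 * min 1 (skew ε L d m n) ≤ c / 3 * (2 * min 1 x) := by gcongr
      _ = 2 / 3 * a := by rw [ha_def]; ring
  have hc₂ : a ≤ c * min 1 (skew ε L d m n) := by rw [ha_def]; gcongr
  have hδ := exp_sub_one_le_mul hε0 hε
  have hcK2 : (c * K) ^ 2 ≤ (1 / 200) ^ 2 := by gcongr
  rcases le_or_gt ((m : ℝ) / n) (1 / √n) with hcase | hcase
  · refine manipulableBy_of_small_skew Pr hPr hδ0 hδ hd hm hn ha0.le ha1 haδ ?_ hc₁ hc₂
    rw [hx, max_eq_left hcase] at hax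
    have ha2 : a ^ 2 ≤ c ^ 2 * (d / (L * ε ^ 2)) * (1 / n) := by
      calc a ^ 2 ≤ (c * (A * (1 / √n))) ^ 2 := by gcongr
        _ = c ^ 2 * A ^ 2 * (1 / √n ^ 2) := by ring
        _ = _ := by rw [hA2, Real.sq_sqrt hn0.le]
    calc n * (a ^ 2 * (8 * (2 * (K * ε) ^ 2 / d)))
        ≤ n * (c ^ 2 * (d / (L * ε ^ 2)) * (1 / n) * (8 * (2 * (K * ε) ^ 2 / d))) := by gcongr
      _ = 16 * (c * K) ^ 2 / L := by field_simp; ring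
      _ ≤ 16 * (1 / 200) ^ 2 / (1 / 2) := by gcongr
      _ ≤ 1 / 50 := by norm_num
  · have hm0 : 0 < m := by
      rcases Nat.eq_zero_or_pos m with h | h
      · rw [h, Nat.cast_zero, zero_div] at hcase
        exact absurd hcase (not_lt.2 (by positivity))
      · exact h
    have hm0' : (0 : ℝ) < m := Nat.cast_pos.2 hm0
    -- The amplification solving m/(10n) * l = a; it is at most 10cA, a bound free of n and m.
    set l := a * (10 * n / m) with hl
    have hl0 : 0 < l := by positivity
    refine manipulableBy_of_tail Pr hPr hδ0 hδ hd hm hm0 ha0.le ha1 haδ (l := l)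
      (by rw [hl]; field_simp) (hunion (K * ε) l fun i s y => ?_) hc₁ hc₂
    rw [hx, max_eq_right hcase.le] at hax
    have hlA : l ≤ 10 * c * A := by
      calc l ≤ c * (A * (m / n)) * (10 * n / m) := by rw [hl]; gcongr
        _ = _ := by field_simp
    have htail := card_lt_abs_le_of_mgf (fun σ => tilt (Pr.rand i) (K * ε) σ s y)
      (V := 2 * (K * ε) ^ 2 / d) (by positivity) (sum_exp_tilt_le (Pr.rand i) hδ0.le s y)
      (t := 1 / (2 * l)) (by positivity)
    have hiff : ∀ σ, 1 / (2 * l) < |tilt (Pr.rand i) (K * ε) σ s y| ↔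
        1 / 2 < |l * tilt (Pr.rand i) (K * ε) σ s y| := fun σ => by
      rw [abs_mul, abs_of_pos hl0, div_lt_iff₀ (by positivity), div_lt_iff₀ two_pos]
      constructor <;> intro h <;> linarith
    simp only [hiff] at htail
    refine htail.trans ?_
    gcongr
    have hlA2 : l ^ 2 ≤ 100 * c ^ 2 * (d / (L * ε ^ 2)) := by
      calc l ^ 2 ≤ (10 * c * A) ^ 2 := by gcongr
        _ = _ := by rw [mul_pow, mul_pow, hA2]; norm_num
    -- The exponent t²/(2V) with t = 1/(2l) and V = 2(Kε)²/d; 25 = 200²/1600 comes from cK ≤ 1/200.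
    calc 25 * L ≤ L / (1600 * (c * K) ^ 2) := by
          rw [le_div_iff₀ (by positivity)]
          nlinarith
      _ = d / (16 * (100 * c ^ 2 * (d / (L * ε ^ 2))) * (K * ε) ^ 2) := by field_simp; norm_num
      _ ≤ d / (16 * l ^ 2 * (K * ε) ^ 2) := by gcongr
      _ = (1 / (2 * l)) ^ 2 / (2 * (2 * (K * ε) ^ 2 / d)) := by field_simp; norm_num

end parameters

/-! ### Conclusion. -/

theorem exp_neg_mul_log {x : ℝ} (hx : 0 < x) : Real.exp (-(25 * Real.log x)) = 1 / x ^ 25 := by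
  rw [Real.exp_neg, show (25 : ℝ) = (25 : ℕ) by norm_num, Real.exp_nat_mul, Real.exp_log hx,
    one_div]

theorem mainTheorem2 (ε₀ : ℝ) (hε₀ : 0 < ε₀) :
    ∃ c₁ c₂ : ℝ, 0 < c₁ ∧ 0 < c₂ ∧
      ∀ (ε : ℝ) (n m d : ℕ) [NeZero d], 0 < ε → ε ≤ ε₀ → 2 ≤ n → m ≤ n → 2 ≤ d →
      ∀ (S : Type*) (Y : Type*) (Z : Type*) [MeasurableSpace S] [MeasurableSpace Y]
        [MeasurableSpace.CountablyGenerated Y] [MeasurableSpace Z]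
        (Pr : LocalProtocol (Fin d) S Y Z n), Pr.IsLDP ε →
        ManipulableBy Pr m c₁ c₂ (min 1 (skew ε (Real.log n) d m n)) ∧
        (Finite Y →
          ManipulableBy Pr m c₁ c₂
            (min 1 (skew ε (Real.log (12 * Nat.card Y * Pr.numRandomizers)) d m n))) := by
  refine ⟨attackConst ε₀ / 3, attackConst ε₀, by linarith [attackConst_pos hε₀],
    attackConst_pos hε₀, ?_⟩
  intro ε n m d _ hε0 hε hn hm hd S Y Z _ _ _ _ Pr hPr
  have hn2 : (2 : ℝ) ≤ n := by exact_mod_cast hn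
  have hpow : ∀ x : ℝ, 2 ≤ x → 20 * x ≤ x ^ 25 := fun x hx => by
    have : (2 : ℝ) ^ 24 ≤ x ^ 24 := by gcongr
    rw [pow_succ]
    nlinarith
  have hlog : ∀ x : ℝ, 2 ≤ x → 1 / 2 ≤ Real.log x := fun x hx => by
    linarith [Real.log_two_gt_d9, Real.log_le_log two_pos hx]
  refine ⟨manipulableBy_of_union_bound Pr hε0 hε hPr hd hm (by omega) (hlog _ hn2)
    fun δ l h => sum_min_le_of_users Pr h ?_, fun hY =>
    manipulableBy_of_union_bound Pr hε0 hε hPr hd hm (by omega) (hlog _ ?_)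
      fun δ l h => sum_min_le_of_finite Pr h ?_⟩
  · have hn0 : (0 : ℝ) < n := by linarith
    rw [exp_neg_mul_log hn0]
    rw [show (n : ℝ) * (2 * (2 * (1 / (n : ℝ) ^ 25))) = 4 * n / (n : ℝ) ^ 25 by ring,
      div_le_iff₀ (by positivity)]
    linarith [hpow n hn2]
  all_goals
    -- `Nat.card Y` and `numRandomizers` are positive because probability measures live on nonempty
    -- spaces and n > 0, so the logarithm is taken at a point at least 2.
    have hS : Nonempty S := by
      by_contra hS
      rw [not_nonempty_iff] at hS
      have := Pr.pub_prob.measure_univ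
      simp [Set.univ_eq_empty_iff.2 hS] at this
    have hYn : Nonempty Y := by
      let i : Fin n := ⟨0, by omega⟩
      exact nonempty_of_isProbabilityMeasure (Pr.rand i (0, hS.some))
    have hcY : (1 : ℝ) ≤ Nat.card Y := by exact_mod_cast Nat.card_pos
    have hcR : (1 : ℝ) ≤ Pr.numRandomizers := by
      have : 0 < Pr.numRandomizers :=
        (Set.ncard_pos (Set.toFinite _)).2 ⟨Pr.rand ⟨0, by omega⟩, Set.mem_range_self _⟩
      exact_mod_cast this
    have hN : (1 : ℝ) ≤ Nat.card Y * Pr.numRandomizers := one_le_mul_of_one_le_of_one_le hcY hcR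
    have hN2 : (2 : ℝ) ≤ 12 * Nat.card Y * Pr.numRandomizers := by linarith
  · exact hN2
  · rw [exp_neg_mul_log (by linarith)]
    have h20 := hpow _ hN2
    rw [show (Nat.card Y : ℝ) * Pr.numRandomizers *
      (2 * (1 / (12 * Nat.card Y * Pr.numRandomizers : ℝ) ^ 25)) =
      2 * (Nat.card Y * Pr.numRandomizers) / (12 * Nat.card Y * Pr.numRandomizers : ℝ) ^ 25 by ring,
      div_le_iff₀ (by positivity)]
    linarith
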